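/- All locally compact spaces are second countable and Hausdorff. \textbf{Conventions.} Let $T$ be a topological space and $U\subset T\times\mathbb{R}^k$ open, with slices $U_t=\{w:(t,w)\in U\}$. A map $f:U\to\mathbb{R}^l$, $f^t=f(t,\cdot)$, is $C^{\infty,0}$ if each $f^t$ is $C^\infty$ on $U_t$ and $t\mapsto f^t$ is continuous for uniform convergence of all derivatives on compact sets (for all $n$, $t_0$ and compact $K\subset U_{t_0}$, $D^nf^t\to D^nf^{t_0}$ uniformly on $K$ as $t\to t_0$). A \emph{continuous family of manifolds} $(X,p)$ over $T$ is a continuous open surjection $p:X\to T$, with fibers $X^t=p^{-1}(t)$, together with, for some $k\ge 0$, an atlas of fiber preserving homeomorphisms (charts) $\phi:U\to p(U)\times W$, with $U\subset X$ and $W\subset\mathbb{R}^k$ open, whose domains cover $X$ and whose transition maps are $C^{\infty,0}$; the atlas is taken maximal. A continuous map $f:X_1\to X_2$ of families over $T_1,T_2$ with $p_2 f=q p_1$, $q:T_1\to T_2$ continuous, defines a \emph{morphism} $(f,q)$ if in charts it has the form $(t,w)\mapsto(q(t),f^t(w))$ with $f^t(w)$ of class $C^{\infty,0}$. For $t:Z\to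 T$ continuous, the pull-back $\{(z,x)\in Z\times X: t(z)=p(x)\}$ is a continuous family over $Z$ in the natural way. A \emph{continuous family groupoid} is a locally compact groupoid $G$ (with continuous multiplication and inversion, unit space $G^0$, range $r$ and source $s$) such that $(G,r)$ and $(G,s)$ are continuous families over $G^0$, inversion is a diffeomorphism $(G,r)\to(G,s)$ (a $C^{\infty,0}$ homeomorphism over $\mathrm{id}_{G^0}$ with $C^{\infty,0}$ inverse), and multiplication $m$ gives a morphism $(m,r)$ from $\{(g,h):s(g)=r(h)\}$, regarded as a family over $G$ by $(g,h)\mapsto g$ (the pull-back of $(G,r)$ along $s$), to $(G,r)$. A \emph{$C^{\infty,0}$ $G$-space} is a continuous family $(X,p)$ over $G^0$, with $X$ locally compact, together with a continuous map $n:(g,x)\mapsto gx$, defined on $G*X=\{(g,x):s(g)=p(x)\}$, such that $p(gx)=r(g)$, $g_1(g_2x)=(g_1g_2)x$, $g^{-1}(gx)=x$, and such that $(n,r)$ is a morphism from $G*X$, regarded as a family over $G$ by $(g,x)\mapsto g$, to $(X,p)$. It is \emph{proper} if $(g,x)\mapsto(gx,x)$, $G*X\to X\times X$, is a proper map. A \emph{$C^{\infty,0}$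 left Haar system} for a $C^{\infty,0}$ $G$-space $(X,p)$ is a family $\{\mu^u\}_{u\in G^0}$ of positive Borel measures $\mu^u$ on $X^u$ such that (i) the support of $\mu^u$ is $X^u$; (ii) for every chart $\phi:U\to p(U)\times W$ of the maximal atlas and every $u\in p(U)$, the measure $E\mapsto\mu^u\big((\phi|_{U\cap X^u})^{-1}(E)\big)$ on $W$ is equivalent to Lebesgue measure $\lambda^W$, and its Radon--Nikodym derivative with respect to $\lambda^W$ is $\rho(u,\cdot)$ for a strictly positive $C^{\infty,0}$ function $\rho$ on $p(U)\times W$; (iii) for all $g\in G$ and all $f\in C_c(X)$, $$\int_{X^{s(g)}}f(gx)\,d\mu^{s(g)}(x)=\int_{X^{r(g)}}f(x)\,d\mu^{r(g)}(x).$$ \textbf{Theorem.} Let $G$ be a continuous family groupoid. Then every proper $C^{\infty,0}$ $G$-space $(X,p)$ admits a $C^{\infty,0}$ left Haar system. Moreover $G$ itself, i.e.\ the $C^{\infty,0}$ $G$-space $(G,r)$ under left multiplication, admits a $C^{\infty,0}$ left Haar system. -/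

import Mathlib

open Set Filter Topology MeasureTheory
open scoped ContDiff

namespace CFam

/-- The model space of the fibers. -/
abbrev Model (k : ℕ) : Type := EuclideanSpace ℝ (Fin k)

/-- The fiber `X^t = p⁻¹({t})`, with the relative topology. -/
abbrev Fibre {X T : Type*} (p : X → T) (t : T) : Type _ := {x : X // p x = t}

/-- The slice of `U ⊆ T × E` over `t`. -/
def slice {T E : Type*} (U : Set (T × E)) (t : T) : Set E := {w | (t, w) ∈ U}

/-- `f` is of class `C^{∞,0}` on the open set `U ⊆ T × E`: every `f t` is smooth on the slice
`U_t`, and `t ↦ f t` is continuous for the topology of uniform convergence on compact sets of all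
derivatives.  (A compact subset of `U_{t₀}` lies in `U_t` for all `t` near `t₀`.) -/
def CInfZeroOn {T E F : Type*} [TopologicalSpace T]
    [NormedAddCommGroup E] [NormedSpace ℝ E] [NormedAddCommGroup F] [NormedSpace ℝ F]
    (U : Set (T × E)) (f : T → E → F) : Prop :=
  (∀ t, ContDiffOn ℝ ∞ (f t) (slice U t)) ∧
  ∀ (n : ℕ) (t₀ : T) (K : Set E), IsCompact K → K ⊆ slice U t₀ →
    TendstoUniformlyOn (fun t => iteratedFDeriv ℝ n (f t)) (iteratedFDeriv ℝ n (f t₀)) (𝓝 t₀) K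

/-- A fiber preserving homeomorphism of an open set `U ⊆ X` onto `p(U) × V`, with `V` open in
`ℝ^k`. -/
def IsFibreChart {X T : Type*} [TopologicalSpace X] [TopologicalSpace T] (p : X → T) {k : ℕ}
    (φ : OpenPartialHomeomorph X (T × Model k)) : Prop :=
  (∀ x ∈ φ.source, (φ x).1 = p x) ∧
  ∃ V : Set (Model k), IsOpen V ∧ φ.target = (p '' φ.source) ×ˢ V

section Coordinates

variable {X₁ X₂ T₁ T₂ : Type*} [TopologicalSpace X₁] [TopologicalSpace X₂]
  [TopologicalSpace T₁] [TopologicalSpace T₂] {k₁ k₂ : ℕ}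

/-- The domain of the expression of `f` in the charts `φ₁`, `φ₂`. -/
def coordDomain (φ₁ : OpenPartialHomeomorph X₁ (T₁ × Model k₁))
    (φ₂ : OpenPartialHomeomorph X₂ (T₂ × Model k₂)) (f : X₁ → X₂) : Set (T₁ × Model k₁) :=
  φ₁.target ∩ φ₁.symm ⁻¹' (f ⁻¹' φ₂.source)

/-- The fiber component `f^t(w)` of `φ₂ ∘ f ∘ φ₁⁻¹ : (t, w) ↦ (q(t), f^t(w))`. -/
def coordRep (φ₁ : OpenPartialHomeomorph X₁ (T₁ × Model k₁))
    (φ₂ : OpenPartialHomeomorph X₂ (T₂ × Model k₂)) (f : X₁ → X₂) : T₁ → Model k₁ → Model k₂ :=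
  fun t w => (φ₂ (f (φ₁.symm (t, w)))).2

/-- The expression of `f` in the charts `φ₁`, `φ₂` is `C^{∞,0}`. -/
def CInfZeroInCharts (φ₁ : OpenPartialHomeomorph X₁ (T₁ × Model k₁))
    (φ₂ : OpenPartialHomeomorph X₂ (T₂ × Model k₂)) (f : X₁ → X₂) : Prop :=
  CInfZeroOn (coordDomain φ₁ φ₂ f) (coordRep φ₁ φ₂ f)

end Coordinates

/-- The structure of a continuous family of manifolds on `p : X → T`, given by an atlas (not
necessarily maximal; the charts of the maximal atlas are those satisfying `IsChart`). -/
structure ContinuousFamily {X T : Type*} [TopologicalSpace X] [TopologicalSpace T]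
    (p : X → T) where
  continuous_proj : Continuous p
  isOpenMap_proj : IsOpenMap p
  surjective_proj : Function.Surjective p
  /-- the dimension of the fibers -/
  dim : ℕ
  atlas : Set (OpenPartialHomeomorph X (T × Model dim))
  cover : ∀ x : X, ∃ φ ∈ atlas, x ∈ φ.source
  isFibreChart : ∀ φ ∈ atlas, IsFibreChart p φ
  compatible : ∀ φ ∈ atlas, ∀ ψ ∈ atlas, CInfZeroInCharts φ ψ id

/-- `φ` is a chart of the family, i.e. belongs to its maximal atlas. -/
def ContinuousFamily.IsChart {X T : Type*} [TopologicalSpace X] [TopologicalSpace T]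
    {p : X → T} (A : ContinuousFamily p) (φ : OpenPartialHomeomorph X (T × Model A.dim)) : Prop :=
  IsFibreChart p φ ∧
    ∀ ψ ∈ A.atlas, CInfZeroInCharts φ ψ id ∧ CInfZeroInCharts ψ φ id

/-- `(f, q)` is a morphism (a `C^{∞,0}` map) of continuous families. -/
structure IsMorphism {X₁ X₂ T₁ T₂ : Type*} [TopologicalSpace X₁] [TopologicalSpace X₂]
    [TopologicalSpace T₁] [TopologicalSpace T₂] {p₁ : X₁ → T₁} {p₂ : X₂ → T₂}
    (A₁ : ContinuousFamily p₁) (A₂ : ContinuousFamily p₂) (f : X₁ → X₂) (q : T₁ → T₂) : Prop where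
  continuous_base : Continuous q
  continuous_map : Continuous f
  proj_map : ∀ x, p₂ (f x) = q (p₁ x)
  cInfZero : ∀ φ₁ ∈ A₁.atlas, ∀ φ₂ ∈ A₂.atlas, CInfZeroInCharts φ₁ φ₂ f

section Pullback

variable {X T Z : Type*} [TopologicalSpace X] [TopologicalSpace T] [TopologicalSpace Z]
  {p : X → T} {t : Z → T}

/-- The projection `t^*X → Z`, where `t^*X = {(z, x) : t(z) = p(x)}`. -/
def pullbackProj (t : Z → T) (p : X → T) : Function.Pullback t p → Z := fun y => y.1.1

open Classical in
/-- The chart of `t^*X` induced by a chart `φ` of `X`: it maps `(z, x)` to `(z, w)` if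
`φ(x) = (t(z), w)`. -/
noncomputable def pullbackChart (hp : Function.Surjective p) (ht : Continuous t) {k : ℕ}
    (φ : OpenPartialHomeomorph X (T × Model k)) (hφ : IsFibreChart p φ) :
    OpenPartialHomeomorph (Function.Pullback t p) (Z × Model k) where
  toFun y := (y.1.1, (φ y.1.2).2)
  invFun v :=
    if h : (t v.1, v.2) ∈ φ.target then
      ⟨(v.1, φ.symm (t v.1, v.2)), by
        have := hφ.1 _ (φ.map_target h)
        rw [φ.right_inv h] at this
        exact this⟩
    else ⟨(v.1, Function.surjInv hp (t v.1)), (Function.surjInv_eq hp (t v.1)).symm⟩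
  source := {y | y.1.2 ∈ φ.source}
  target := {v | (t v.1, v.2) ∈ φ.target}
  map_source' y hy := by
    have h1 := hφ.1 _ hy
    have h2 := y.2
    have h3 := φ.map_source hy
    have : (t y.1.1, (φ y.1.2).2) = φ y.1.2 := Prod.ext (h2.trans h1.symm) rfl
    change (t y.1.1, (φ y.1.2).2) ∈ φ.target
    rw [this]; exact h3
  map_target' v hv := by
    have hv' : (t v.1, v.2) ∈ φ.target := hv
    simp only [dif_pos hv']
    exact φ.map_target hv'
  left_inv' y hy := by
    have h1 := hφ.1 _ hy
    have h2 := y.2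
    have h3 := φ.map_source hy
    have h4 : (t y.1.1, (φ y.1.2).2) = φ y.1.2 := Prod.ext (h2.trans h1.symm) rfl
    have h5 : (t y.1.1, (φ y.1.2).2) ∈ φ.target := by rw [h4]; exact h3
    rw [dif_pos h5]
    apply Subtype.ext
    apply Prod.ext
    · rfl
    · change φ.symm (t y.1.1, (φ y.1.2).2) = y.1.2
      rw [h4]; exact φ.left_inv hy
  right_inv' v hv := by
    have hv' : (t v.1, v.2) ∈ φ.target := hv
    simp only [dif_pos hv']
    rw [φ.right_inv hv']
  open_source := φ.open_source.preimage (continuous_snd.comp continuous_subtype_val)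
  open_target := φ.open_target.preimage
    ((ht.comp continuous_fst).prodMk continuous_snd)
  continuousOn_toFun := by
    refine ContinuousOn.prodMk (continuous_fst.comp continuous_subtype_val).continuousOn ?_
    refine continuous_snd.comp_continuousOn ?_
    exact φ.continuousOn.comp (continuous_snd.comp continuous_subtype_val).continuousOn
      (fun y hy => hy)
  continuousOn_invFun := by
    rw [continuousOn_iff_continuous_domRestrict]
    refine Continuous.subtype_mk (f := fun v : {v : Z × Model k | (t v.1, v.2) ∈ φ.target} =>
      (v.1.1, φ.symm (t v.1.1, v.1.2))) ?_ ?_ |>.congr ?_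
    · refine (continuous_fst.comp continuous_subtype_val).prodMk ?_
      have := φ.continuousOn_symm.comp_continuous
        (f := fun v : {v : Z × Model k | (t v.1, v.2) ∈ φ.target} => (t v.1.1, v.1.2))
        (((ht.comp continuous_fst).prodMk continuous_snd).comp continuous_subtype_val)
        (fun v => v.2)
      exact this
    · intro v
      have := hφ.1 _ (φ.map_target v.2)
      rw [φ.right_inv v.2] at this
      exact this
    · intro v
      have hv : (t v.1.1, v.1.2) ∈ φ.target := v.2
      simp [hv]

/-- Base change and change off an open set preserve the class `C^{∞,0}`. -/
theorem CInfZeroOn.comp_base {E F : Type*}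
    [NormedAddCommGroup E] [NormedSpace ℝ E] [NormedAddCommGroup F] [NormedSpace ℝ F]
    {U : Set (T × E)} {f : T → E → F} (hf : CInfZeroOn U f) (ht : Continuous t)
    {U' : Set (Z × E)} (hU' : IsOpen U') (hsub : ∀ z w, (z, w) ∈ U' → (t z, w) ∈ U)
    {f' : Z → E → F} (heq : ∀ z w, (z, w) ∈ U' → f' z w = f (t z) w) : CInfZeroOn U' f' := by
  have hsl : ∀ z, IsOpen (slice U' z) := fun z => hU'.preimage (by fun_prop)
  have hder : ∀ n z w, (z, w) ∈ U' →
      iteratedFDeriv ℝ n (f' z) w = iteratedFDeriv ℝ n (f (t z)) w := by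
    intro n z w hw
    have : f' z =ᶠ[𝓝 w] f (t z) := by
      filter_upwards [(hsl z).mem_nhds hw] with w' hw' using heq z w' hw'
    exact (this.iteratedFDeriv ℝ n).eq_of_nhds
  refine ⟨fun z => ((hf.1 (t z)).mono fun w hw => hsub z w hw).congr fun w hw => heq z w hw, ?_⟩
  intro n z₀ K hK hKU u hu
  have h1 := hf.2 n (t z₀) K hK (fun w hw => hsub z₀ w (hKU hw)) u hu
  have h2 : ∀ᶠ z in 𝓝 z₀, ∀ w ∈ K, (z, w) ∈ U' := by
    obtain ⟨V, W, hV, -, hzV, hKW, hVW⟩ := generalized_tube_lemma (isCompact_singleton (x := z₀))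
      hK hU' (by rintro ⟨z, w⟩ ⟨rfl, hw⟩; exact hKU hw)
    filter_upwards [hV.mem_nhds (hzV rfl)] with z hz w hw using hVW ⟨hz, hKW hw⟩
  filter_upwards [ht.continuousAt.eventually h1, h2] with z hz hz' w hw
  rw [hder n z w (hz' w hw), hder n z₀ w (hKU hw)]
  exact hz w hw

theorem pullbackChart_isFibreChart (hp : Function.Surjective p) (ht : Continuous t) {k : ℕ}
    (φ : OpenPartialHomeomorph X (T × Model k)) (hφ : IsFibreChart p φ) :
    IsFibreChart (pullbackProj t p) (pullbackChart hp ht φ hφ) := by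
  refine ⟨fun _ _ => rfl, ?_⟩
  obtain ⟨V, hV, hVt⟩ := hφ.2
  refine ⟨V, hV, ?_⟩
  ext ⟨z, w⟩
  change (t z, w) ∈ φ.target ↔ _
  rw [hVt, mem_prod, mem_prod]
  refine and_congr_left fun _ => ?_
  constructor
  · rintro ⟨x, hx, hxz⟩
    exact ⟨⟨(z, x), hxz.symm⟩, hx, rfl⟩
  · rintro ⟨y, hy, rfl⟩
    exact ⟨y.1.2, hy, y.2.symm⟩

open Classical in
theorem pullbackChart_compatible (hp : Function.Surjective p) (ht : Continuous t) {k : ℕ}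
    (φ ψ : OpenPartialHomeomorph X (T × Model k)) (hφ : IsFibreChart p φ) (hψ : IsFibreChart p ψ)
    (h : CInfZeroInCharts φ ψ id) :
    CInfZeroInCharts (pullbackChart hp ht φ hφ) (pullbackChart hp ht ψ hψ) id := by
  have key : ∀ z w, (t z, w) ∈ φ.target →
      ((pullbackChart hp ht φ hφ).symm (z, w)).1.2 = φ.symm (t z, w) := by
    intro z w hzw
    change (dite _ _ _ : Function.Pullback t p).1.2 = _
    rw [dif_pos hzw]
  refine CInfZeroOn.comp_base h ht ?_ ?_ ?_
  · exact (pullbackChart hp ht φ hφ).isOpen_inter_preimage_symm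
      (pullbackChart hp ht ψ hψ).open_source
  · rintro z w ⟨h1, h2⟩
    refine ⟨h1, ?_⟩
    have h2' : ((pullbackChart hp ht φ hφ).symm (z, w)).1.2 ∈ ψ.source := h2
    rw [key z w h1] at h2'
    exact h2'
  · rintro z w ⟨h1, h2⟩
    change (ψ ((pullbackChart hp ht φ hφ).symm (z, w)).1.2).2 = (ψ (φ.symm (t z, w))).2
    rw [key z w h1]

/-- The pull-back family `(t^*X, p')` over `Z` of a continuous family `(X, p)` over `T` along a
continuous map `t : Z → T`. -/
def ContinuousFamily.pullback (A : ContinuousFamily p) (ht : Continuous t) :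
    ContinuousFamily (pullbackProj t p) where
  continuous_proj := continuous_fst.comp continuous_subtype_val
  isOpenMap_proj := by
    rw [isOpenMap_iff_nhds_le]
    rintro ⟨⟨z, x⟩, hzx⟩ S hS
    obtain ⟨N, hN, hNS⟩ := mem_nhds_induced (Subtype.val : Function.Pullback t p → Z × X) _ _ |>.1
      (mem_map.1 hS)
    obtain ⟨N₁, hN₁, N₂, hN₂, hNN⟩ := mem_nhds_prod_iff.1 hN
    have h2 : p '' N₂ ∈ 𝓝 (t z) := by
      have hzx' : t z = p x := hzx
      rw [hzx']
      exact A.isOpenMap_proj.image_mem_nhds hN₂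
    change S ∈ 𝓝 z
    filter_upwards [hN₁, ht.continuousAt h2] with z' h1 h3
    obtain ⟨x', hx', hxz⟩ := h3
    exact hNS (show (⟨(z', x'), hxz.symm⟩ : Function.Pullback t p) ∈ _ from hNN ⟨h1, hx'⟩)
  surjective_proj z := by
    obtain ⟨x, hx⟩ := A.surjective_proj (t z)
    exact ⟨⟨(z, x), hx.symm⟩, rfl⟩
  dim := A.dim
  atlas := {χ | ∃ φ, ∃ hφ : φ ∈ A.atlas,
    χ = pullbackChart A.surjective_proj ht φ (A.isFibreChart φ hφ)}
  cover y := by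
    obtain ⟨φ, hφ, hx⟩ := A.cover y.1.2
    exact ⟨_, ⟨φ, hφ, rfl⟩, hx⟩
  isFibreChart := by
    rintro _ ⟨φ, hφ, rfl⟩
    exact pullbackChart_isFibreChart _ _ _ _
  compatible := by
    rintro _ ⟨φ, hφ, rfl⟩ _ ⟨ψ, hψ, rfl⟩
    exact pullbackChart_compatible _ _ _ _ _ _ (A.compatible φ hφ ψ hψ)

end Pullback

/-- A topological groupoid with space of arrows `G` and space of units `B` (embedded in `G` by
`unit`); the product `gh` is defined if `s(g) = r(h)`. -/
structure TopGroupoid (G B : Type*) [TopologicalSpace G] [TopologicalSpace B] where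
  r : G → B
  s : G → B
  unit : B → G
  mul : (g h : G) → s g = r h → G
  inv : G → G
  r_unit : ∀ u, r (unit u) = u
  s_unit : ∀ u, s (unit u) = u
  r_mul : ∀ g h (e : s g = r h), r (mul g h e) = r g
  s_mul : ∀ g h (e : s g = r h), s (mul g h e) = s h
  mul_assoc : ∀ g h k (e : s g = r h) (e' : s h = r k),
    mul (mul g h e) k ((s_mul g h e).trans e') = mul g (mul h k e') (e.trans (r_mul h k e').symm)
  unit_mul : ∀ g, mul (unit (r g)) g (s_unit (r g)) = g
  mul_unit : ∀ g, mul g (unit (s g)) (r_unit (s g)).symm = g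
  r_inv : ∀ g, r (inv g) = s g
  s_inv : ∀ g, s (inv g) = r g
  mul_inv : ∀ g, mul g (inv g) (r_inv g).symm = unit (r g)
  inv_mul : ∀ g, mul (inv g) g (s_inv g) = unit (s g)
  continuous_r : Continuous r
  continuous_s : Continuous s
  continuous_unit : Continuous unit
  continuous_mul : Continuous fun z : Function.Pullback s r => mul z.1.1 z.1.2 z.2
  continuous_inv : Continuous inv

/-- A continuous family groupoid (the space `G` is required to be locally compact, Hausdorff and
second countable where this structure is used). -/
structure ContinuousFamilyGroupoid (G B : Type*) [TopologicalSpace G] [TopologicalSpace B]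
    extends TopGroupoid G B where
  /-- the continuous family `(G, r)` -/
  famR : ContinuousFamily r
  /-- the continuous family `(G, s)` -/
  famS : ContinuousFamily s
  /-- inversion is a diffeomorphism `(G, r) → (G, s)`; it is its own inverse -/
  inv_morphism : IsMorphism famR famS inv id
  inv_morphism' : IsMorphism famS famR inv id
  /-- `(m, r)` is a morphism `(G * G, t₁) → (G, r)`, where `(G * G, t₁)` is the pull-back of
  `(G, r)` along `s` -/
  mul_morphism : IsMorphism (famR.pullback continuous_s) famR
    (fun z : Function.Pullback s r => mul z.1.1 z.1.2 z.2) r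

/-- A `C^{∞,0}` `G`-space `(X, p)`. -/
structure CInfZeroSpace {G B : Type*} [TopologicalSpace G] [TopologicalSpace B]
    (𝒢 : ContinuousFamilyGroupoid G B) (X : Type*) [TopologicalSpace X] where
  p : X → B
  fam : ContinuousFamily p
  act : (g : G) → (x : X) → 𝒢.s g = p x → X
  p_act : ∀ g x (e : 𝒢.s g = p x), p (act g x e) = 𝒢.r g
  act_act : ∀ g₁ g₂ x (e₂ : 𝒢.s g₂ = p x) (e₁ : 𝒢.s g₁ = 𝒢.r g₂),
    act g₁ (act g₂ x e₂) (e₁.trans (p_act g₂ x e₂).symm) =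
      act (𝒢.mul g₁ g₂ e₁) x ((𝒢.s_mul g₁ g₂ e₁).trans e₂)
  inv_act : ∀ g x (e : 𝒢.s g = p x),
    act (𝒢.inv g) (act g x e) ((𝒢.s_inv g).trans (p_act g x e).symm) = x
  continuous_act : Continuous fun z : Function.Pullback 𝒢.s p => act z.1.1 z.1.2 z.2
  /-- `(n, r)` is a morphism `(G * X, t₁) → (X, p)`, where `n(g, x) = gx` -/
  act_morphism : IsMorphism (fam.pullback 𝒢.continuous_s) fam
    (fun z : Function.Pullback 𝒢.s p => act z.1.1 z.1.2 z.2) 𝒢.r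

section Haar

variable {G B X : Type*} [TopologicalSpace G] [TopologicalSpace B] [TopologicalSpace X]
  {𝒢 : ContinuousFamilyGroupoid G B}

/-- The action is proper: `(g, x) ↦ (gx, x)` is a proper map `G * X → X × X`. -/
def CInfZeroSpace.IsProper (S : CInfZeroSpace 𝒢 X) : Prop :=
  IsProperMap fun z : Function.Pullback 𝒢.s S.p => (S.act z.1.1 z.1.2 z.2, z.1.2)

/-- The measure `μ^u ∘ φ^u` on `ℝ^k`, concentrated on the `W` of `φ(U) = p(U) × W`; it maps `E` to
`μ^u ((φ^u)⁻¹ E)`, where `φ^u` is the restriction of the chart `φ` to `X^u ∩ U`. -/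
noncomputable def chartMeasure [MeasurableSpace X] {p : X → B} {k : ℕ}
    (φ : OpenPartialHomeomorph X (B × Model k)) (u : B) (μu : Measure (Fibre p u)) :
    Measure (Model k) :=
  (μu.restrict {x : Fibre p u | x.1 ∈ φ.source}).map fun x => (φ x.1).2

/-- `{μ^u}` is a `C^{∞,0}` left Haar system for the `C^{∞,0}` `G`-space `(X, p)`. -/
structure IsCInfZeroHaarSystem [MeasurableSpace X] (S : CInfZeroSpace 𝒢 X)
    (μ : (u : B) → Measure (Fibre S.p u)) : Prop where
  support_eq : ∀ u, (μ u).support = univ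
  /-- In each chart, `μ^u` is equivalent to Lebesgue measure `λ^W` on `W` and the Radon-Nikodym
  derivative is a (strictly positive) `C^{∞,0}` function `ρ` on `p(U) × W`. -/
  density : ∀ φ, S.fam.IsChart φ →
    (∀ u, chartMeasure φ u (μ u) ≪ volume.restrict (slice φ.target u) ∧
      volume.restrict (slice φ.target u) ≪ chartMeasure φ u (μ u)) ∧
    ∃ ρ : B → Model S.fam.dim → ℝ, CInfZeroOn φ.target ρ ∧
      (∀ u, ∀ w ∈ slice φ.target u, 0 < ρ u w) ∧
      ∀ u, chartMeasure φ u (μ u) =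
        (volume.restrict (slice φ.target u)).withDensity fun w => ENNReal.ofReal (ρ u w)
  invariant : ∀ (g : G) (f : X → ℂ), Continuous f → HasCompactSupport f →
    ∫ x : Fibre S.p (𝒢.s g), f (S.act g x.1 x.2.symm) ∂(μ (𝒢.s g)) =
      ∫ x : Fibre S.p (𝒢.r g), f x.1 ∂(μ (𝒢.r g))

end Haar

/-- `(G, r)` as a `C^{∞,0}` `G`-space under left multiplication. -/
def ContinuousFamilyGroupoid.leftSpace {G B : Type*} [TopologicalSpace G] [TopologicalSpace B]
    (𝒢 : ContinuousFamilyGroupoid G B) : CInfZeroSpace 𝒢 G where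
  p := 𝒢.r
  fam := 𝒢.famR
  act := 𝒢.mul
  p_act := 𝒢.r_mul
  act_act g₁ g₂ x e₂ e₁ := (𝒢.mul_assoc g₁ g₂ x e₁ e₂).symm
  inv_act g x e := by
    rw [← 𝒢.mul_assoc (𝒢.inv g) g x (𝒢.s_inv g) e]
    have key : ∀ (a : G) (h : 𝒢.s a = 𝒢.r x), a = 𝒢.unit (𝒢.r x) → 𝒢.mul a x h = x := by
      rintro _ h rfl
      exact 𝒢.unit_mul x
    apply key
    rw [𝒢.inv_mul, e]
  continuous_act := 𝒢.continuous_mul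
  act_morphism := 𝒢.mul_morphism

end CFam

/-! It suffices to find a strictly positive invariant 1-density of class C^{∞,0} along the fibers of
X (`CInfZeroSpace.IsDensity`). One identity, d(gx) · |det D(x ↦ gx)| = d(x), with g read in two
charts, contains both the invariance and, when g is a unit, the rule for changing charts. By the
change of variables formula such a density defines measures on the fibers, glued over countably many
charts (`exists_isDensityMeasure`), and the identity becomes their invariance
(`IsDensityMeasure.map_smul`).

The density is built in two stages. On G, a left invariant density is determined along the units:
its value at y is the value at the unit s(y) transported by y. Continuous data on the units thus
give an invariant density, but only a continuous one is obtained, because the transporting arrow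
moves with the point and Jacobians are only known to be continuous in the arrow
(`exists_isDensity_leftSpace`). This is enough to integrate over the r-fibers.

On a proper G-space, a bump density supported in one chart is then translated by all γ in the
r-fiber and integrated (`isDensity_integral_translate`). Left invariance of the measures on G makes
the average invariant. The translates are smooth along the fibers of X, with derivatives jointly
continuous in γ and the point, and properness locally confines the contributing γ to a compact set.
Hence one may differentiate under the integral, and the average is C^{∞,0} although the measures on
G have merely continuous densities. The average is positive where the bump is, because of the
contribution of the units, and a countable sum with small weights is positive everywhere
(`exists_isDensity_pos`). Finally G is a proper space over itself, so the same averaging gives its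
own smooth Haar system. -/

namespace CFam

/-! ### Calculus of functions of class C^{n,0} -/

section Calculus

universe v

set_option linter.unusedSectionVars false

variable {T T' : Type*} [TopologicalSpace T] [TopologicalSpace T']

/-- `f` is of class `C^{n,0}` on `U`: the derivatives of order at most `n` in the second variable
exist on `U` and are jointly continuous. -/
def CkZeroOn : (n : ℕ) → {E F : Type v} → [NormedAddCommGroup E] → [NormedSpace ℝ E] →
    [NormedAddCommGroup F] → [NormedSpace ℝ F] → Set (T × E) → (T → E → F) → Prop
  | 0, _, _, _, _, _, _, U, f => ContinuousOn (fun p => f p.1 p.2) U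
  | n + 1, _, _, _, _, _, _, U, f => ContinuousOn (fun p => f p.1 p.2) U ∧
      (∀ p ∈ U, DifferentiableAt ℝ (f p.1) p.2) ∧ CkZeroOn n U fun t => fderiv ℝ (f t)

variable {E E' F F₁ F₂ F₃ : Type v}
  [NormedAddCommGroup E] [NormedSpace ℝ E] [NormedAddCommGroup E'] [NormedSpace ℝ E']
  [NormedAddCommGroup F] [NormedSpace ℝ F] [NormedAddCommGroup F₁] [NormedSpace ℝ F₁]
  [NormedAddCommGroup F₂] [NormedSpace ℝ F₂] [NormedAddCommGroup F₃] [NormedSpace ℝ F₃]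

theorem isOpen_slice {U : Set (T × E)} (hU : IsOpen U) (t : T) : IsOpen (slice U t) :=
  hU.preimage (by fun_prop)

theorem slice_mem_nhds {U : Set (T × E)} (hU : IsOpen U) {p : T × E} (hp : p ∈ U) :
    ∀ᶠ w in 𝓝 p.2, (p.1, w) ∈ U :=
  (isOpen_slice hU p.1).mem_nhds hp

namespace CkZeroOn

theorem continuousOn {n : ℕ} {U : Set (T × E)} {f : T → E → F} (h : CkZeroOn n U f) :
    ContinuousOn (fun p : T × E => f p.1 p.2) U := by
  cases n with
  | zero => exact h
  | succ n => exact h.1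

theorem of_succ {n : ℕ} {U : Set (T × E)} {f : T → E → F} (h : CkZeroOn (n + 1) U f) :
    CkZeroOn n U f := by
  induction n generalizing F with
  | zero => exact h.1
  | succ n ih => exact ⟨h.1, h.2.1, ih h.2.2⟩

theorem of_le {m n : ℕ} (hmn : m ≤ n) {U : Set (T × E)} {f : T → E → F} (h : CkZeroOn n U f) :
    CkZeroOn m U f := by
  induction n, hmn using Nat.le_induction with
  | base => exact h
  | succ n _ ih => exact ih h.of_succ

theorem mono {n : ℕ} {U U' : Set (T × E)} {f : T → E → F} (h : CkZeroOn n U f) (hU : U' ⊆ U) :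
    CkZeroOn n U' f := by
  induction n generalizing F with
  | zero => exact ContinuousOn.mono h hU
  | succ n ih => exact ⟨h.1.mono hU, fun p hp => h.2.1 p (hU hp), ih h.2.2⟩

theorem fderiv_congr {U : Set (T × E)} (hU : IsOpen U) {f g : T → E → F}
    (hfg : ∀ p ∈ U, f p.1 p.2 = g p.1 p.2) :
    ∀ p ∈ U, fderiv ℝ (f p.1) p.2 = fderiv ℝ (g p.1) p.2 := fun p hp =>
  Filter.EventuallyEq.fderiv_eq ((slice_mem_nhds hU hp).mono fun w hw => hfg (p.1, w) hw)

theorem congr {n : ℕ} {U : Set (T × E)} (hU : IsOpen U) {f g : T → E → F} (h : CkZeroOn n U f)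
    (hfg : ∀ p ∈ U, g p.1 p.2 = f p.1 p.2) : CkZeroOn n U g := by
  induction n generalizing F with
  | zero => exact ContinuousOn.congr h hfg
  | succ n ih =>
    refine ⟨h.1.congr hfg, fun p hp => (h.2.1 p hp).congr_of_eventuallyEq
      ((slice_mem_nhds hU hp).mono fun w hw => hfg (p.1, w) hw), ih h.2.2 (fderiv_congr hU hfg)⟩

theorem of_local {n : ℕ} {U : Set (T × E)} {f : T → E → F}
    (h : ∀ p ∈ U, ∃ V, IsOpen V ∧ p ∈ V ∧ CkZeroOn n V f) : CkZeroOn n U f := by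
  have h0 : ContinuousOn (fun p : T × E => f p.1 p.2) U := fun p hp => by
    obtain ⟨V, hV, hpV, hf⟩ := h p hp
    exact (hf.continuousOn.continuousAt (hV.mem_nhds hpV)).continuousWithinAt
  induction n generalizing F with
  | zero => exact h0
  | succ n ih =>
    have h1 : ∀ p ∈ U, ∃ V, IsOpen V ∧ p ∈ V ∧ CkZeroOn n V fun t => fderiv ℝ (f t) := fun p hp => by
      obtain ⟨V, hV, hpV, hf⟩ := h p hp
      exact ⟨V, hV, hpV, hf.2.2⟩
    refine ⟨h0, fun p hp => ?_, ih h1 fun p hp => ?_⟩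
    · obtain ⟨V, hV, hpV, hf⟩ := h p hp
      exact hf.2.1 p hpV
    · obtain ⟨V, hV, hpV, hf⟩ := h1 p hp
      exact (hf.continuousOn.continuousAt (hV.mem_nhds hpV)).continuousWithinAt

theorem const {n : ℕ} {U : Set (T × E)} {a : T → F}
    (ha : ContinuousOn (fun p : T × E => a p.1) U) : CkZeroOn n U fun t (_ : E) => a t := by
  induction n generalizing F with
  | zero => exact ha
  | succ n ih =>
    refine ⟨ha, fun _ _ => differentiableAt_const _, ?_⟩
    have : (fun t => fderiv ℝ fun _ : E => a t) = fun _ _ => (0 : E →L[ℝ] F) := by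
      funext t w; simp
    rw [this]
    exact ih continuousOn_const

theorem id {n : ℕ} {U : Set (T × E)} : CkZeroOn n U fun _ (w : E) => w := by
  cases n with
  | zero => exact continuous_snd.continuousOn
  | succ n =>
    refine ⟨continuous_snd.continuousOn, fun _ _ => differentiableAt_id, ?_⟩
    have : (fun _ : T => fderiv ℝ fun w : E => w) = fun _ _ => ContinuousLinearMap.id ℝ E := by
      funext t w; simp
    rw [this]
    exact const continuousOn_const

theorem add {n : ℕ} {U : Set (T × E)} (hU : IsOpen U) {f g : T → E → F} (hf : CkZeroOn n U f)
    (hg : CkZeroOn n U g) : CkZeroOn n U fun t w => f t w + g t w := by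
  induction n generalizing F with
  | zero => exact ContinuousOn.add hf hg
  | succ n ih =>
    refine ⟨hf.1.add hg.1, fun p hp => (hf.2.1 p hp).fun_add (hg.2.1 p hp), ?_⟩
    exact (ih hf.2.2 hg.2.2).congr hU fun p hp => fderiv_fun_add (hf.2.1 p hp) (hg.2.1 p hp)

theorem sum {ι : Type*} (s : Finset ι) {n : ℕ} {U : Set (T × E)} (hU : IsOpen U)
    {f : ι → T → E → F} (hf : ∀ i ∈ s, CkZeroOn n U (f i)) :
    CkZeroOn n U fun t w => ∑ i ∈ s, f i t w := by
  classical
  induction s using Finset.induction_on with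
  | empty => simpa using const (continuousOn_const (c := (0 : F)))
  | insert i s hi ih =>
    simp only [Finset.sum_insert hi]
    exact (hf i (Finset.mem_insert_self i s)).add hU
      (ih fun j hj => hf j (Finset.mem_insert_of_mem hj))

/-- The product rule writes the derivative as a sum of two expressions of the same kind, for the
bilinear maps `L.precompR E` and `L.precompL E`; the induction therefore lets all three spaces vary.
-/
theorem bilinear (L : F₁ →L[ℝ] F₂ →L[ℝ] F₃) {n : ℕ} {U : Set (T × E)} (hU : IsOpen U)
    {f : T → E → F₁} {g : T → E → F₂} (hf : CkZeroOn n U f) (hg : CkZeroOn n U g) :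
    CkZeroOn n U fun t w => L (f t w) (g t w) := by
  induction n generalizing F₁ F₂ F₃ with
  | zero => exact L.continuous₂.comp_continuousOn (ContinuousOn.prodMk hf hg)
  | succ n ih =>
    refine ⟨L.continuous₂.comp_continuousOn (hf.1.prodMk hg.1), fun p hp =>
      (L.hasFDerivAt_of_bilinear (hf.2.1 p hp).hasFDerivAt
        (hg.2.1 p hp).hasFDerivAt).differentiableAt, ?_⟩
    refine ((ih (L.precompR E) hf.of_succ hg.2.2).add hU
      (ih (L.precompL E) hf.2.2 hg.of_succ)).congr hU fun p hp => ?_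
    exact L.fderiv_of_bilinear (hf.2.1 p hp) (hg.2.1 p hp)

/-- By the chain rule the derivative is the bilinear composition of Dg ∘ f, covered by induction,
with Df. Only derivatives along the fibers occur, so continuity of the base map q suffices. -/
theorem comp {n : ℕ} {U : Set (T × E)} (hU : IsOpen U) {U' : Set (T' × E')} {f : T → E → E'}
    {q : T → T'} {g : T' → E' → F} (hg : CkZeroOn n U' g) (hf : CkZeroOn n U f)
    (hq : ContinuousOn (fun p : T × E => q p.1) U) (hm : ∀ p ∈ U, (q p.1, f p.1 p.2) ∈ U') :
    CkZeroOn n U fun t w => g (q t) (f t w) := by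
  induction n generalizing F with
  | zero =>
    exact ContinuousOn.comp (f := fun p : T × E => (q p.1, f p.1 p.2)) hg
      (ContinuousOn.prodMk hq hf) hm
  | succ n ih =>
    refine ⟨hg.1.comp (f := fun p : T × E => (q p.1, f p.1 p.2)) (hq.prodMk hf.1) hm,
      fun p hp => (hg.2.1 _ (hm p hp)).comp p.2 (hf.2.1 p hp), ?_⟩
    refine (bilinear (ContinuousLinearMap.compL ℝ E E' F) hU (ih hg.2.2 hf.of_succ) hf.2.2).congr
      hU fun p hp => ?_
    exact fderiv_comp p.2 (hg.2.1 _ (hm p hp)) (hf.2.1 p hp)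

theorem comp_base {n : ℕ} {U : Set (T × E)} (hU : IsOpen U) {U' : Set (T' × E)}
    {q : T → T'} {g : T' → E → F} (hg : CkZeroOn n U' g)
    (hq : ContinuousOn (fun p : T × E => q p.1) U) (hm : ∀ p ∈ U, (q p.1, p.2) ∈ U') :
    CkZeroOn n U fun t w => g (q t) w :=
  hg.comp hU id hq hm

theorem of_contDiffOn {n : ℕ} {V : Set E} (hV : IsOpen V) {g : E → F} (hg : ContDiffOn ℝ n g V)
    {U : Set (T × E)} (hU : ∀ p ∈ U, p.2 ∈ V) : CkZeroOn n U fun _ => g := by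
  have h0 : ContinuousOn (fun p : T × E => g p.2) U :=
    hg.continuousOn.comp continuous_snd.continuousOn hU
  induction n generalizing F with
  | zero => exact h0
  | succ n ih =>
    have h1 := (contDiffOn_succ_iff_fderiv_of_isOpen (n := n) hV).1 (by exact_mod_cast hg)
    exact ⟨h0, fun p hp => h1.1.differentiableAt (hV.mem_nhds (hU p hp)),
      ih h1.2.2 (h1.2.2.continuousOn.comp continuous_snd.continuousOn hU)⟩

theorem contDiffOn_comp {n : ℕ} {V : Set E'} (hV : IsOpen V) {g : E' → F}
    (hg : ContDiffOn ℝ n g V) {U : Set (T × E)} (hU : IsOpen U) {f : T → E → E'}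
    (hf : CkZeroOn n U f) (hm : ∀ p ∈ U, f p.1 p.2 ∈ V) : CkZeroOn n U fun t w => g (f t w) :=
  comp (q := fun t => t) (U' := {p : T × E' | p.2 ∈ V}) hU (of_contDiffOn hV hg fun _ hp => hp)
    hf continuous_fst.continuousOn hm

theorem contDiffOn {n : ℕ} {U : Set (T × E)} (hU : IsOpen U) {f : T → E → F}
    (h : CkZeroOn n U f) (t : T) : ContDiffOn ℝ n (f t) (slice U t) := by
  induction n generalizing F with
  | zero =>
    exact contDiffOn_zero.2 (ContinuousOn.comp (f := fun w : E => (t, w)) h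
      (by fun_prop) fun w hw => hw)
  | succ n ih =>
    refine (contDiffOn_succ_iff_fderiv_of_isOpen (n := n) (isOpen_slice hU t)).2
      ⟨fun w hw => (h.2.1 (t, w) hw).differentiableWithinAt, by simp, ih h.2.2⟩

theorem continuousOn_iteratedFDeriv {n : ℕ} {U : Set (T × E)} {f : T → E → F}
    (h : CkZeroOn n U f) : ContinuousOn (fun p : T × E => iteratedFDeriv ℝ n (f p.1) p.2) U := by
  induction n generalizing F with
  | zero =>
    simp only [iteratedFDeriv_zero_eq_comp, Function.comp_def]
    exact (LinearIsometryEquiv.continuous _).comp_continuousOn h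
  | succ n ih =>
    simp only [iteratedFDeriv_succ_eq_comp_right, Function.comp_def]
    exact (LinearIsometryEquiv.continuous _).comp_continuousOn (ih h.2.2)

end CkZeroOn

/-- A tube lemma argument: for compact K the neighborhood filter of {t₀} × K is a product filter, so
pointwise closeness near each (t₀, w) becomes uniform on K for t near t₀. -/
theorem tendstoUniformlyOn_of_continuousOn {U : Set (T × E)} (hU : IsOpen U) {f : T → E → F}
    (hf : ContinuousOn (fun p : T × E => f p.1 p.2) U) {t₀ : T} {K : Set E} (hK : IsCompact K)
    (hKU : K ⊆ slice U t₀) : TendstoUniformlyOn f (f t₀) (𝓝 t₀) K := by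
  rw [Metric.tendstoUniformlyOn_iff]
  intro ε hε
  have h1 : ∀ w ∈ K, ∀ᶠ p : T × E in 𝓝 (t₀, w), dist (f t₀ p.2) (f p.1 p.2) < ε := by
    intro w hw
    have hm : (t₀, w) ∈ U := hKU hw
    have h2 : ContinuousAt (fun p : T × E => f p.1 p.2) (t₀, w) :=
      hf.continuousAt (hU.mem_nhds hm)
    have h3 : ContinuousAt (fun p : T × E => f t₀ p.2) (t₀, w) :=
      ContinuousAt.comp (f := fun p : T × E => (t₀, p.2)) (g := fun p : T × E => f p.1 p.2)
        h2 (by fun_prop)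
    have h4 := (h3.dist h2)
    have : dist (f t₀ w) (f t₀ w) < ε := by simpa using hε
    exact h4.eventually (gt_mem_nhds this)
  have h2 : ∀ᶠ p : T × E in (𝓝 t₀) ×ˢ (𝓝ˢ K), dist (f t₀ p.2) (f p.1 p.2) < ε := by
    rw [← nhdsSet_singleton, ← (isCompact_singleton (x := t₀)).nhdsSet_prod_eq hK]
    refine eventually_nhdsSet_iff_forall.2 ?_
    rintro ⟨t, w⟩ ⟨rfl, hw⟩
    exact h1 w hw
  obtain ⟨P, hP, Q, hQ, hPQ⟩ := eventually_prod_iff.1 h2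
  filter_upwards [hP] with t ht w hw
  exact hPQ ht (hQ.self_of_nhdsSet _ hw)

theorem cInfZeroOn_of_ckZeroOn {U : Set (T × E)} (hU : IsOpen U) {f : T → E → F}
    (h : ∀ n, CkZeroOn n U f) : CInfZeroOn U f :=
  ⟨fun t => contDiffOn_infty.2 fun n => (h n).contDiffOn hU t, fun n _ _ hK hKU =>
    tendstoUniformlyOn_of_continuousOn hU (h n).continuousOn_iteratedFDeriv hK hKU⟩

/-- Uniform convergence on a compact neighborhood of w, together with continuity of f t there, gives
joint continuity by an ε/2 argument; local compactness supplies the neighborhood. -/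
theorem CInfZeroOn.continuousOn [LocallyCompactSpace E] {U : Set (T × E)} (hU : IsOpen U)
    {f : T → E → F} (h : CInfZeroOn U f) : ContinuousOn (fun p : T × E => f p.1 p.2) U := by
  rintro ⟨t, w⟩ hp
  apply ContinuousAt.continuousWithinAt
  obtain ⟨K, hK, hwK, hKU⟩ := exists_compact_subset (isOpen_slice hU t)
    (show w ∈ slice U t from hp)
  have h1 := h.2 0 t K hK hKU
  have h2 : TendstoUniformlyOn f (f t) (𝓝 t) K := by
    rw [Metric.tendstoUniformlyOn_iff] at h1 ⊢
    intro ε hε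
    filter_upwards [h1 ε hε] with t' ht' w' hw'
    simpa only [iteratedFDeriv_zero_eq_comp, Function.comp_def,
      LinearIsometryEquiv.dist_map] using ht' w' hw'
  have h3 : ContinuousAt (f t) w :=
    (h.1 t).continuousOn.continuousAt ((isOpen_slice hU t).mem_nhds hp)
  rw [Metric.tendstoUniformlyOn_iff] at h2
  rw [Metric.continuousAt_iff'] at h3 ⊢
  intro ε hε
  rw [nhds_prod_eq]
  have hK' : ∀ᶠ w' in 𝓝 w, w' ∈ K := mem_interior_iff_mem_nhds.1 hwK
  filter_upwards [(h2 (ε / 2) (by positivity)).prod_mk ((h3 (ε / 2) (by positivity)).and hK')]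
    with p hp'
  have h4 := hp'.1 p.2 hp'.2.2
  rw [dist_comm] at h4
  calc dist (f p.1 p.2) (f t w) ≤ dist (f p.1 p.2) (f t p.2) + dist (f t p.2) (f t w) :=
        dist_triangle _ _ _
    _ < ε := by linarith [hp'.2.1]

theorem CInfZeroOn.fderiv {U : Set (T × E)} (hU : IsOpen U)
    {f : T → E → F} (h : CInfZeroOn U f) : CInfZeroOn U fun t => fderiv ℝ (f t) := by
  refine ⟨fun t => (h.1 t).fderiv_of_isOpen (isOpen_slice hU t) (by simp), ?_⟩
  intro n t₀ K hK hKU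
  have h1 := h.2 (n + 1) t₀ K hK hKU
  rw [Metric.tendstoUniformlyOn_iff] at h1 ⊢
  intro ε hε
  filter_upwards [h1 ε hε] with t ht w hw
  have := ht w hw
  simpa only [iteratedFDeriv_succ_eq_comp_right, Function.comp_def,
    LinearIsometryEquiv.dist_map] using this

/-- Together with `cInfZeroOn_of_ckZeroOn`, this allows all further work to be done with joint
continuity of derivatives instead of uniform convergence. -/
theorem CInfZeroOn.ckZeroOn [LocallyCompactSpace E] {U : Set (T × E)} (hU : IsOpen U)
    {f : T → E → F} (h : CInfZeroOn U f) (n : ℕ) : CkZeroOn n U f := by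
  induction n generalizing F with
  | zero => exact h.continuousOn hU
  | succ n ih =>
    exact ⟨h.continuousOn hU, fun p hp => ((h.1 p.1).differentiableOn (by simp)).differentiableAt
      ((isOpen_slice hU p.1).mem_nhds hp), ih (h.fderiv hU)⟩

end Calculus

end CFam

namespace CFam

/-! ### Determinants, series and parameter integrals in class C^{n,0} -/

section CalculusIntegral

universe v

set_option linter.unusedSectionVars false

variable {T Z : Type*} [TopologicalSpace T] [TopologicalSpace Z]
  {E F : Type v} [NormedAddCommGroup E] [NormedSpace ℝ E] [NormedAddCommGroup F] [NormedSpace ℝ F]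

/-- In a basis the Leibniz formula makes the determinant a polynomial in coordinates that are linear
in A. -/
theorem contDiff_det [FiniteDimensional ℝ E] {n : WithTop ℕ∞} :
    ContDiff ℝ n fun A : E →L[ℝ] E => A.det := by
  classical
  let b := Module.finBasis ℝ E
  have h : (fun A : E →L[ℝ] E => A.det) = fun A => ∑ σ : Equiv.Perm _,
      ((Equiv.Perm.sign σ : ℤ) : ℝ) * ∏ i, b.repr (A (b i)) (σ i) := by
    funext A
    rw [ContinuousLinearMap.det, ← LinearMap.det_toMatrix b, Matrix.det_apply']
    simp [LinearMap.toMatrix_apply]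
  rw [h]
  refine ContDiff.sum fun σ _ => contDiff_const.mul (contDiff_prod fun i _ => ?_)
  have : (fun A : E →L[ℝ] E => b.repr (A (b i)) (σ i)) = fun A =>
      (LinearMap.toContinuousLinearMap (b.coord (σ i))) ((ContinuousLinearMap.apply ℝ E (b i)) A) := by
    funext A; simp
  rw [this]
  fun_prop

theorem contDiffOn_abs_det [FiniteDimensional ℝ E] {n : ℕ∞} :
    ContDiffOn ℝ n (fun A : E →L[ℝ] E => |A.det|) {A | A.det ≠ 0} := fun _ hA =>
  ((contDiffAt_abs hA).comp _ contDiff_det.contDiffAt).contDiffWithinAt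

theorem isOpen_det_ne_zero [FiniteDimensional ℝ E] : IsOpen {A : E →L[ℝ] E | A.det ≠ 0} :=
  isOpen_ne_fun (contDiff_det (n := 0)).continuous continuous_const

namespace CkZeroOn

theorem mul {n : ℕ} {T : Type*} [TopologicalSpace T] {E : Type} [NormedAddCommGroup E]
    [NormedSpace ℝ E] {U : Set (T × E)} (hU : IsOpen U) {f g : T → E → ℝ}
    (hf : CkZeroOn n U f) (hg : CkZeroOn n U g) : CkZeroOn n U fun t w => f t w * g t w :=
  bilinear (ContinuousLinearMap.mul ℝ ℝ) hU hf hg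

/-- Series with locally summable bounds on the derivatives. -/
theorem tsum [CompleteSpace F] {n : ℕ} {U : Set (T × E)} {f : ℕ → T → E → F}
    (hf : ∀ i, CkZeroOn n U (f i))
    (hb : ∀ p ∈ U, ∃ N ∈ 𝓝 p, ∀ m ≤ n, ∃ u : ℕ → ℝ, Summable u ∧
      ∀ i, ∀ q ∈ N, ‖iteratedFDeriv ℝ m (f i q.1) q.2‖ ≤ u i) (hU : IsOpen U) :
    CkZeroOn n U fun t w => ∑' i, f i t w := by
  have h0 : ContinuousOn (fun p : T × E => ∑' i, f i p.1 p.2) U := by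
    intro p hp
    obtain ⟨N, hN, h⟩ := hb p hp
    obtain ⟨u, hu, hle⟩ := h 0 (Nat.zero_le _)
    have : ContinuousOn (fun p : T × E => ∑' i, f i p.1 p.2) (N ∩ U) :=
      continuousOn_tsum (fun i => (hf i).continuousOn.mono inter_subset_right) hu
        fun i q hq => by simpa using hle i q hq.1
    exact (this.continuousAt (inter_mem hN (hU.mem_nhds hp))).continuousWithinAt
  induction n generalizing F with
  | zero => exact h0
  | succ n ih =>
    have hder : ∀ p ∈ U, HasFDerivAt (fun w => ∑' i, f i p.1 w)
        (∑' i, fderiv ℝ (f i p.1) p.2) p.2 := by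
      rintro ⟨t, w⟩ hp
      obtain ⟨N, hN, h⟩ := hb _ hp
      obtain ⟨u, hu, hle⟩ := h 1 (by omega)
      obtain ⟨u₀, hu₀, hle₀⟩ := h 0 (by omega)
      have hs : {w' | (t, w') ∈ N ∩ U} ∈ 𝓝 w :=
        (by fun_prop : Continuous fun w' : E => (t, w')).continuousAt.preimage_mem_nhds
          (inter_mem hN (hU.mem_nhds hp))
      obtain ⟨ε, hε, hball⟩ := Metric.mem_nhds_iff.1 hs
      have h1 : ∀ i, ∀ x ∈ Metric.ball w ε, HasFDerivAt (f i t) (fderiv ℝ (f i t) x) x :=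
        fun i x hx => ((hf i).2.1 (t, x) (hball hx).2).hasFDerivAt
      have h2 : ∀ i, ∀ x ∈ Metric.ball w ε, ‖fderiv ℝ (f i t) x‖ ≤ u i := fun i x hx => by
        rw [← norm_iteratedFDeriv_one]
        exact hle i (t, x) (hball hx).1
      refine hasFDerivAt_tsum_of_isPreconnected hu Metric.isOpen_ball
        (convex_ball w ε).isPreconnected h1 h2
        (Metric.mem_ball_self hε) ?_ (Metric.mem_ball_self hε)
      · refine Summable.of_norm_bounded hu₀ fun i => ?_
        simpa using hle₀ i _ (hball (Metric.mem_ball_self hε)).1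
    have hb' : ∀ p ∈ U, ∃ N ∈ 𝓝 p, ∀ m ≤ n, ∃ u : ℕ → ℝ, Summable u ∧
        ∀ i, ∀ q ∈ N, ‖iteratedFDeriv ℝ m (fderiv ℝ (f i q.1)) q.2‖ ≤ u i := by
      intro p hp
      obtain ⟨N, hN, h⟩ := hb p hp
      refine ⟨N, hN, fun m hm => ?_⟩
      simpa only [norm_iteratedFDeriv_fderiv] using h (m + 1) (by omega)
    refine ⟨h0, fun p hp => (hder p hp).differentiableAt, ?_⟩
    refine CkZeroOn.congr hU (ih (fun i => (hf i).2.2) hb' ?_) fun p hp => (hder p hp).fderiv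
    intro p hp
    obtain ⟨N, hN, h⟩ := hb' p hp
    obtain ⟨u, hu, hle⟩ := h 0 (Nat.zero_le _)
    have : ContinuousOn (fun p : T × E => ∑' i, fderiv ℝ (f i p.1) p.2) (N ∩ U) :=
      continuousOn_tsum (fun i => (hf i).2.2.continuousOn.mono inter_subset_right) hu
        fun i q hq => by simpa using hle i q hq.1
    exact (this.continuousAt (inter_mem hN (hU.mem_nhds hp))).continuousWithinAt

/-- Differentiation under the integral sign: on a compact neighborhood K of the point, the
derivative is bounded on K × C and vanishes for z outside C, so a constant on C dominates it. -/
theorem integral [LocallyCompactSpace E] [MeasurableSpace Z] [OpensMeasurableSpace Z]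
    [SecondCountableTopology Z] [T2Space Z] [CompleteSpace F] (ν : Measure Z)
    [IsFiniteMeasureOnCompacts ν] {n : ℕ} {U : Set (T × E)} (hU : IsOpen U) {C : Set Z}
    (hC : IsCompact C) {f : T × Z → E → F} (hf : CkZeroOn n {p | (p.1.1, p.2) ∈ U} f)
    (h0 : ∀ p ∈ U, ∀ z ∉ C, f (p.1, z) p.2 = 0) :
    CkZeroOn n U fun t w => ∫ z, f (t, z) w ∂ν := by
  -- Stated for every target, since the argument is applied to f and to its derivative alike.
  have hcont : ∀ {F : Type v} [NormedAddCommGroup F] [NormedSpace ℝ F] {f : T × Z → E → F},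
      ContinuousOn (fun p : (T × Z) × E => f p.1 p.2) {p | (p.1.1, p.2) ∈ U} →
      (∀ p ∈ U, ∀ z ∉ C, f (p.1, z) p.2 = 0) →
      ContinuousOn (fun p : T × E => ∫ z, f (p.1, z) p.2 ∂ν) U := by
    intro F _ _ f hf h0
    refine continuousOn_integral_of_compact_support (f := fun (p : T × E) z => f (p.1, z) p.2) hC
      ?_ fun p z hp hz => h0 p hp z hz
    exact hf.comp (f := fun q : (T × E) × Z => ((q.1.1, q.2), q.1.2)) (by fun_prop)
      fun q hq => hq.1
  have hslice : ∀ {F : Type v} [NormedAddCommGroup F] [NormedSpace ℝ F] {f : T × Z → E → F},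
      ContinuousOn (fun p : (T × Z) × E => f p.1 p.2) {p | (p.1.1, p.2) ∈ U} →
      ∀ p ∈ U, Continuous fun z => f (p.1, z) p.2 := by
    intro F _ _ f hf p hp
    exact hf.comp_continuous (f := fun z => ((p.1, z), p.2)) (by fun_prop) fun z => hp
  induction n generalizing F with
  | zero => exact hcont hf h0
  | succ n ih =>
    have h0' : ∀ p ∈ U, ∀ z ∉ C, fderiv ℝ (f (p.1, z)) p.2 = 0 := by
      intro p hp z hz
      have : f (p.1, z) =ᶠ[𝓝 p.2] fun _ => 0 :=
        (slice_mem_nhds hU hp).mono fun w hw => h0 (p.1, w) hw z hz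
      rw [this.fderiv_eq]
      simp
    have hder : ∀ p ∈ U, HasFDerivAt (fun w => ∫ z, f (p.1, z) w ∂ν)
        (∫ z, fderiv ℝ (f (p.1, z)) p.2 ∂ν) p.2 := by
      rintro ⟨t, w⟩ hp
      obtain ⟨K, hK, hwK, hKU⟩ := exists_compact_subset (isOpen_slice hU t)
        (show w ∈ slice U t from hp)
      have hcts : ContinuousOn (fun q : E × Z => fderiv ℝ (f (t, q.2)) q.1) (K ×ˢ C) :=
        hf.2.2.continuousOn.comp (f := fun q : E × Z => ((t, q.2), q.1)) (by fun_prop)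
          fun q hq => hKU hq.1
      obtain ⟨M, hM⟩ := (hK.prod hC).exists_bound_of_continuousOn hcts
      refine hasFDerivAt_integral_of_dominated_of_fderiv_le (s := K)
        (F := fun x z => f (t, z) x) (F' := fun x z => fderiv ℝ (f (t, z)) x)
        (bound := C.indicator fun _ => M)
        (mem_interior_iff_mem_nhds.1 hwK) ?_ ?_ ?_ ?_ ?_ ?_
      · exact (slice_mem_nhds hU hp).mono fun w' hw' =>
          (hslice hf.1 (t, w') hw').aestronglyMeasurable
      · refine (hslice hf.1 (t, w) hp).integrable_of_hasCompactSupport ?_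
        exact HasCompactSupport.intro hC fun z hz => h0 (t, w) hp z hz
      · exact (hslice (f := fun q => fderiv ℝ (f q)) hf.2.2.continuousOn (t, w) hp).aestronglyMeasurable
      · refine Eventually.of_forall fun z x hx => ?_
        by_cases hz : z ∈ C
        · rw [indicator_of_mem hz]
          exact hM (x, z) ⟨hx, hz⟩
        · rw [indicator_of_notMem hz, h0' (t, x) (hKU hx) z hz, norm_zero]
      · rw [integrable_indicator_iff hC.isClosed.measurableSet]
        exact integrableOn_const hC.measure_ne_top
      · exact Eventually.of_forall fun z x hx => (hf.2.1 ((t, z), x) (hKU hx)).hasFDerivAt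
    refine ⟨hcont hf.1 h0, fun p hp => (hder p hp).differentiableAt, ?_⟩
    exact (ih hf.2.2 h0').congr hU fun p hp => (hder p hp).fderiv

end CkZeroOn

end CalculusIntegral

end CFam

namespace CFam

/-! ### Fiber preserving charts -/

section FibreChart

variable {X T : Type*} [TopologicalSpace X] [TopologicalSpace T] {p : X → T} {k : ℕ}
  {φ : OpenPartialHomeomorph X (T × Model k)}

theorem IsFibreChart.proj_symm (h : IsFibreChart p φ) {v : T × Model k} (hv : v ∈ φ.target) :
    p (φ.symm v) = v.1 := by
  rw [← h.1 _ (φ.map_target hv), φ.right_inv hv]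

theorem IsFibreChart.mk_snd (h : IsFibreChart p φ) {x : X} (hx : x ∈ φ.source) {t : T}
    (ht : p x = t) : (t, (φ x).2) = φ x :=
  Prod.ext (ht.symm.trans (h.1 x hx).symm) rfl

theorem IsFibreChart.symm_mk_snd (h : IsFibreChart p φ) {x : X} (hx : x ∈ φ.source) {t : T}
    (ht : p x = t) : φ.symm (t, (φ x).2) = x := by
  rw [h.mk_snd hx ht, φ.left_inv hx]

theorem IsFibreChart.mk_snd_mem (h : IsFibreChart p φ) {x : X} (hx : x ∈ φ.source) {t : T}
    (ht : p x = t) : (t, (φ x).2) ∈ φ.target := by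
  rw [h.mk_snd hx ht]; exact φ.map_source hx

theorem ContinuousFamily.isChart_of_mem_atlas (A : ContinuousFamily p)
    {φ : OpenPartialHomeomorph X (T × Model A.dim)} (hφ : φ ∈ A.atlas) : A.IsChart φ :=
  ⟨A.isFibreChart φ hφ, fun ψ hψ => ⟨A.compatible φ hφ ψ hψ, A.compatible ψ hψ φ hφ⟩⟩

end FibreChart

/-! ### Groupoid identities and the action in charts -/

section Action

variable {G B X : Type*} [TopologicalSpace G] [TopologicalSpace B] [TopologicalSpace X]
  {𝒢 : ContinuousFamilyGroupoid G B}

namespace CInfZeroSpace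

/-- The charts of the maximal atlas. -/
abbrev Chart (S : CInfZeroSpace 𝒢 X) : Type _ :=
  {φ : OpenPartialHomeomorph X (B × Model S.fam.dim) // S.fam.IsChart φ}

open Classical in
/-- The action, extended to all pairs by `g • x = x` where it is not defined. -/
noncomputable def smul (S : CInfZeroSpace 𝒢 X) (g : G) (x : X) : X :=
  if e : 𝒢.s g = S.p x then S.act g x e else x

variable {S : CInfZeroSpace 𝒢 X}

theorem smul_eq {g : G} {x : X} (e : 𝒢.s g = S.p x) : S.smul g x = S.act g x e := dif_pos e

theorem p_smul {g : G} {x : X} (e : 𝒢.s g = S.p x) : S.p (S.smul g x) = 𝒢.r g := by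
  rw [smul_eq e, S.p_act]

end CInfZeroSpace

/-- The product of the groupoid, extended to all pairs. -/
noncomputable def ContinuousFamilyGroupoid.prod (𝒢 : ContinuousFamilyGroupoid G B) (g h : G) : G :=
  𝒢.leftSpace.smul g h

namespace ContinuousFamilyGroupoid

theorem prod_eq {g h : G} (e : 𝒢.s g = 𝒢.r h) : 𝒢.prod g h = 𝒢.mul g h e := dif_pos e

theorem r_prod {g h : G} (e : 𝒢.s g = 𝒢.r h) : 𝒢.r (𝒢.prod g h) = 𝒢.r g := by
  rw [prod_eq e, 𝒢.r_mul]

theorem s_prod {g h : G} (e : 𝒢.s g = 𝒢.r h) : 𝒢.s (𝒢.prod g h) = 𝒢.s h := by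
  rw [prod_eq e, 𝒢.s_mul]

theorem inv_prod_self (g : G) : 𝒢.prod (𝒢.inv g) g = 𝒢.unit (𝒢.s g) := by
  rw [prod_eq (𝒢.s_inv g), 𝒢.inv_mul]

theorem prod_inv (g : G) : 𝒢.prod g (𝒢.inv g) = 𝒢.unit (𝒢.r g) := by
  rw [prod_eq (𝒢.r_inv g).symm, 𝒢.mul_inv]

theorem prod_unit {g : G} {u : B} (h : 𝒢.s g = u) : 𝒢.prod g (𝒢.unit u) = g := by
  subst h
  rw [prod_eq (𝒢.r_unit _).symm, 𝒢.mul_unit]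

end ContinuousFamilyGroupoid

open ContinuousFamilyGroupoid

namespace CInfZeroSpace

variable {S : CInfZeroSpace 𝒢 X}

theorem smul_smul {g₁ g₂ : G} {x : X} (e₂ : 𝒢.s g₂ = S.p x) (e₁ : 𝒢.s g₁ = 𝒢.r g₂) :
    S.smul g₁ (S.smul g₂ x) = S.smul (𝒢.prod g₁ g₂) x := by
  have h := S.act_act g₁ g₂ x e₂ e₁
  rw [← smul_eq, ← smul_eq] at h
  rw [prod_eq e₁, h, smul_eq]

theorem inv_smul_smul {g : G} {x : X} (e : 𝒢.s g = S.p x) :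
    S.smul (𝒢.inv g) (S.smul g x) = x := by
  have h := S.inv_act g x e
  rw [← smul_eq] at h
  rwa [smul_eq e]

/-- Not an axiom of a G-space: it follows from g⁻¹(gx) = x with g the unit at u, because g⁻¹g is
again that unit. -/
theorem unit_smul {u : B} {x : X} (e : S.p x = u) : S.smul (𝒢.unit u) x = x := by
  have h : 𝒢.s (𝒢.unit u) = S.p x := (𝒢.s_unit u).trans e.symm
  have h1 := inv_smul_smul h
  rwa [smul_smul h (𝒢.s_inv _), inv_prod_self, 𝒢.s_unit] at h1

theorem continuousOn_smul :
    ContinuousOn (fun q : G × X => S.smul q.1 q.2) {q | 𝒢.s q.1 = S.p q.2} := by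
  rw [continuousOn_iff_continuous_domRestrict]
  exact S.continuous_act.congr fun z => (smul_eq z.2).symm

end CInfZeroSpace

namespace ContinuousFamilyGroupoid

theorem inv_inv_eq (g : G) : 𝒢.inv (𝒢.inv g) = g := by
  have h : 𝒢.prod (𝒢.inv (𝒢.inv g)) (𝒢.prod (𝒢.inv g) g) = g :=
    CInfZeroSpace.inv_smul_smul (S := 𝒢.leftSpace) (𝒢.s_inv g)
  rwa [inv_prod_self, prod_unit] at h
  rw [𝒢.s_inv, 𝒢.r_inv]

theorem prod_assoc {g h k : G} (e : 𝒢.s g = 𝒢.r h) (e' : 𝒢.s h = 𝒢.r k) :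
    𝒢.prod g (𝒢.prod h k) = 𝒢.prod (𝒢.prod g h) k :=
  CInfZeroSpace.smul_smul (S := 𝒢.leftSpace) e' e

theorem unit_prod {g : G} {u : B} (h : 𝒢.r g = u) : 𝒢.prod (𝒢.unit u) g = g :=
  CInfZeroSpace.unit_smul (S := 𝒢.leftSpace) h

theorem inv_unit (u : B) : 𝒢.inv (𝒢.unit u) = 𝒢.unit u := by
  have h := inv_prod_self (𝒢 := 𝒢) (𝒢.unit u)
  rwa [prod_unit ((𝒢.s_inv _).trans (𝒢.r_unit u)), 𝒢.s_unit] at h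

theorem inv_prod_prod {g h : G} (e : 𝒢.s g = 𝒢.r h) : 𝒢.prod (𝒢.inv g) (𝒢.prod g h) = h :=
  CInfZeroSpace.inv_smul_smul (S := 𝒢.leftSpace) e

theorem inv_prod_rev {g h : G} (e : 𝒢.s g = 𝒢.r h) :
    𝒢.inv (𝒢.prod g h) = 𝒢.prod (𝒢.inv h) (𝒢.inv g) := by
  have e1 : 𝒢.s (𝒢.inv (𝒢.prod g h)) = 𝒢.r (𝒢.prod g h) := 𝒢.s_inv _
  have e2 : 𝒢.s (𝒢.inv h) = 𝒢.r (𝒢.inv g) := by rw [𝒢.s_inv, 𝒢.r_inv, e]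
  have e3 : 𝒢.s (𝒢.prod (𝒢.inv h) (𝒢.inv g)) = 𝒢.r (𝒢.prod g h) := by
    rw [s_prod e2, 𝒢.s_inv, r_prod e]
  have h1 : 𝒢.prod (𝒢.prod (𝒢.inv h) (𝒢.inv g)) (𝒢.prod g h) = 𝒢.unit (𝒢.s (𝒢.prod g h)) := by
    rw [← prod_assoc e2 ((𝒢.s_inv g).trans (r_prod e).symm), inv_prod_prod e, inv_prod_self, s_prod e]
  have h2 := prod_assoc (g := 𝒢.prod (𝒢.inv h) (𝒢.inv g)) (h := 𝒢.prod g h)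
    (k := 𝒢.inv (𝒢.prod g h)) e3 (𝒢.r_inv _).symm
  rw [h1, prod_inv, prod_unit e3, unit_prod (𝒢.r_inv _)] at h2
  exact h2.symm

end ContinuousFamilyGroupoid

namespace CInfZeroSpace

variable {S : CInfZeroSpace 𝒢 X}

theorem smul_inv_smul {g : G} {x : X} (e : 𝒢.r g = S.p x) :
    S.smul g (S.smul (𝒢.inv g) x) = x := by
  have := inv_smul_smul (S := S) (g := 𝒢.inv g) (x := x) ((𝒢.s_inv g).trans e)
  rwa [inv_inv_eq] at this

/-- The expression of `x ↦ g x` in the charts `φ` and `ψ`. -/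
noncomputable def actRep (S : CInfZeroSpace 𝒢 X)
    (φ ψ : OpenPartialHomeomorph X (B × Model S.fam.dim)) (g : G) (w : Model S.fam.dim) :
    Model S.fam.dim :=
  (ψ (S.smul g (φ.symm (𝒢.s g, w)))).2

/-- The domain of `actRep`. -/
def actDom (S : CInfZeroSpace 𝒢 X)
    (φ ψ : OpenPartialHomeomorph X (B × Model S.fam.dim)) : Set (G × Model S.fam.dim) :=
  {q | (𝒢.s q.1, q.2) ∈ φ.target ∧ S.smul q.1 (φ.symm (𝒢.s q.1, q.2)) ∈ ψ.source}

/-- The absolute value of the Jacobian determinant of `x ↦ g x` in the charts `φ` and `ψ`. -/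
noncomputable def jac (S : CInfZeroSpace 𝒢 X)
    (φ ψ : OpenPartialHomeomorph X (B × Model S.fam.dim)) (g : G) (w : Model S.fam.dim) : ℝ :=
  |(fderiv ℝ (S.actRep φ ψ g) w).det|

theorem continuousOn_smul_symm (φ : S.Chart) :
    ContinuousOn (fun q : G × Model S.fam.dim => S.smul q.1 (φ.1.symm (𝒢.s q.1, q.2)))
      {q | (𝒢.s q.1, q.2) ∈ φ.1.target} := by
  have hs := 𝒢.continuous_s
  refine continuousOn_smul.comp
    (f := fun q : G × Model S.fam.dim => (q.1, φ.1.symm (𝒢.s q.1, q.2)))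
    (continuousOn_fst.prodMk (φ.1.continuousOn_symm.comp
      (f := fun q : G × Model S.fam.dim => (𝒢.s q.1, q.2)) (by fun_prop) fun q hq => hq)) ?_
  intro q hq
  exact (φ.2.1.proj_symm hq).symm

theorem isOpen_actDom (φ ψ : S.Chart) : IsOpen (S.actDom φ.1 ψ.1) := by
  have hs := 𝒢.continuous_s
  exact (continuousOn_smul_symm φ).isOpen_inter_preimage
    (φ.1.open_target.preimage (by fun_prop)) ψ.1.open_source

section

variable {φ ψ χ : S.Chart} {g g₁ g₂ : G} {w : Model S.fam.dim}

theorem s_eq_of_mem_actDom (h : (g, w) ∈ S.actDom φ.1 ψ.1) :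
    𝒢.s g = S.p (φ.1.symm (𝒢.s g, w)) := (φ.2.1.proj_symm h.1).symm

theorem actRep_mem_target (h : (g, w) ∈ S.actDom φ.1 ψ.1) :
    (𝒢.r g, S.actRep φ.1 ψ.1 g w) ∈ ψ.1.target :=
  ψ.2.1.mk_snd_mem h.2 (p_smul (s_eq_of_mem_actDom h))

theorem symm_actRep (h : (g, w) ∈ S.actDom φ.1 ψ.1) :
    ψ.1.symm (𝒢.r g, S.actRep φ.1 ψ.1 g w) = S.smul g (φ.1.symm (𝒢.s g, w)) :=
  ψ.2.1.symm_mk_snd h.2 (p_smul (s_eq_of_mem_actDom h))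

theorem mem_actDom_prod_iff (h : (g₂, w) ∈ S.actDom φ.1 ψ.1) (e : 𝒢.s g₁ = 𝒢.r g₂) :
    (g₁, S.actRep φ.1 ψ.1 g₂ w) ∈ S.actDom ψ.1 χ.1 ↔ (𝒢.prod g₁ g₂, w) ∈ S.actDom φ.1 χ.1 := by
  simp only [actDom, mem_ofPred_eq, s_prod e, e, symm_actRep h, actRep_mem_target h, h.1, true_and,
    smul_smul (s_eq_of_mem_actDom h) e]

theorem actRep_actRep (h : (g₂, w) ∈ S.actDom φ.1 ψ.1) (e : 𝒢.s g₁ = 𝒢.r g₂) :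
    S.actRep ψ.1 χ.1 g₁ (S.actRep φ.1 ψ.1 g₂ w) = S.actRep φ.1 χ.1 (𝒢.prod g₁ g₂) w := by
  rw [actRep, e, symm_actRep h, smul_smul (s_eq_of_mem_actDom h) e, actRep, s_prod e]

theorem mem_actDom_unit {u : B} (h : (u, w) ∈ φ.1.target) :
    (𝒢.unit u, w) ∈ S.actDom φ.1 ψ.1 ↔ φ.1.symm (u, w) ∈ ψ.1.source := by
  simp only [actDom, mem_ofPred_eq, 𝒢.s_unit, h, true_and, unit_smul (φ.2.1.proj_symm h)]

theorem actRep_unit {u : B} (h : (u, w) ∈ φ.1.target) :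
    S.actRep φ.1 ψ.1 (𝒢.unit u) w = (ψ.1 (φ.1.symm (u, w))).2 := by
  simp only [actRep, 𝒢.s_unit, unit_smul (φ.2.1.proj_symm h)]

theorem actRep_unit_self {u : B} (h : (u, w) ∈ φ.1.target) :
    S.actRep φ.1 φ.1 (𝒢.unit u) w = w := by
  rw [actRep_unit h, φ.1.right_inv h]

theorem inv_mem_actDom (h : (g, w) ∈ S.actDom φ.1 ψ.1) :
    (𝒢.inv g, S.actRep φ.1 ψ.1 g w) ∈ S.actDom ψ.1 φ.1 := by
  rw [mem_actDom_prod_iff h (𝒢.s_inv g), inv_prod_self, mem_actDom_unit h.1]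
  exact φ.1.map_target h.1

theorem actRep_inv_actRep (h : (g, w) ∈ S.actDom φ.1 ψ.1) :
    S.actRep ψ.1 φ.1 (𝒢.inv g) (S.actRep φ.1 ψ.1 g w) = w := by
  rw [actRep_actRep h (𝒢.s_inv g), inv_prod_self, actRep_unit_self h.1]

end

-- This is the hypothesis that the action is a morphism, read in the pull-back chart; on its target
-- the inverse of that chart is (g, w) ↦ (g, φ⁻¹(s(g), w)).
open Classical in
theorem ckZeroOn_actRep_of_mem_atlas {φ ψ : OpenPartialHomeomorph X (B × Model S.fam.dim)}
    (hφ : φ ∈ S.fam.atlas) (hψ : ψ ∈ S.fam.atlas) (n : ℕ) :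
    CkZeroOn n (S.actDom φ ψ) (S.actRep φ ψ) := by
  have hφ' := S.fam.isFibreChart φ hφ
  let χ := pullbackChart S.fam.surjective_proj 𝒢.continuous_s φ hφ'
  have key : ∀ v : G × Model S.fam.dim, (𝒢.s v.1, v.2) ∈ φ.target →
      S.act (χ.symm v).1.1 (χ.symm v).1.2 (χ.symm v).2 = S.smul v.1 (φ.symm (𝒢.s v.1, v.2)) := by
    intro v hv
    have h1 : (χ.symm v).1 = (v.1, φ.symm (𝒢.s v.1, v.2)) := by
      change (dite _ _ _ : Function.Pullback 𝒢.s S.p).1 = _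
      rw [dif_pos hv]
    rw [← smul_eq, h1]
  have h := S.act_morphism.cInfZero χ ⟨φ, hφ, rfl⟩ ψ hψ
  have hopen : IsOpen (coordDomain χ ψ
      fun z : Function.Pullback 𝒢.s S.p => S.act z.1.1 z.1.2 z.2) :=
    χ.isOpen_inter_preimage_symm (ψ.open_source.preimage S.continuous_act)
  have hsub : S.actDom φ ψ ⊆ coordDomain χ ψ
      fun z : Function.Pullback 𝒢.s S.p => S.act z.1.1 z.1.2 z.2 := by
    intro v hv
    refine ⟨hv.1, ?_⟩
    change S.act (χ.symm v).1.1 (χ.symm v).1.2 (χ.symm v).2 ∈ ψ.source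
    rw [key v hv.1]
    exact hv.2
  refine ((h.ckZeroOn hopen n).mono hsub).congr
    (isOpen_actDom ⟨φ, S.fam.isChart_of_mem_atlas hφ⟩ ⟨ψ, S.fam.isChart_of_mem_atlas hψ⟩) ?_
  intro v hv
  change (ψ _).2 = (ψ (S.act (χ.symm v).1.1 (χ.symm v).1.2 (χ.symm v).2)).2
  rw [key v hv.1]

/-- Passage to the maximal atlas: near a given point the expression in φ, ψ factors as the
transition from φ to an atlas chart φ', the action from φ' to an atlas chart ψ', and the transition
from ψ' to ψ. -/
theorem ckZeroOn_actRep (φ ψ : S.Chart) (n : ℕ) :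
    CkZeroOn n (S.actDom φ.1 ψ.1) (S.actRep φ.1 ψ.1) := by
  have hs := 𝒢.continuous_s
  have hr := 𝒢.continuous_r
  refine CkZeroOn.of_local ?_
  rintro ⟨g, w⟩ hgw
  obtain ⟨φ', hφ', hx⟩ := S.fam.cover (φ.1.symm (𝒢.s g, w))
  obtain ⟨ψ', hψ', hy⟩ := S.fam.cover (S.smul g (φ.1.symm (𝒢.s g, w)))
  let Φ : S.Chart := ⟨φ', S.fam.isChart_of_mem_atlas hφ'⟩
  let Ψ : S.Chart := ⟨ψ', S.fam.isChart_of_mem_atlas hψ'⟩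
  have ho : IsOpen {q : G × Model S.fam.dim | (𝒢.s q.1, q.2) ∈ φ.1.target ∧
      φ.1.symm (𝒢.s q.1, q.2) ∈ φ'.source} :=
    (φ.1.isOpen_inter_preimage_symm φ'.open_source).preimage
      (f := fun q : G × Model S.fam.dim => (𝒢.s q.1, q.2)) (by fun_prop)
  have hV : IsOpen ((S.actDom φ.1 ψ.1 ∩ S.actDom φ.1 ψ') ∩
      {q | (𝒢.s q.1, q.2) ∈ φ.1.target ∧ φ.1.symm (𝒢.s q.1, q.2) ∈ φ'.source}) :=
    ((isOpen_actDom φ ψ).inter (isOpen_actDom φ Ψ)).inter ho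
  refine ⟨_, hV, ⟨⟨hgw, hgw.1, hy⟩, hgw.1, hx⟩, ?_⟩
  have h1 : CkZeroOn n _ _ := ((φ.2.2 φ' hφ').1.ckZeroOn
    (φ.1.isOpen_inter_preimage_symm (φ'.open_source)) n).comp_base (q := 𝒢.s) hV
      (by fun_prop) fun q hq => hq.2
  have hsymm : ∀ q : G × Model S.fam.dim, (𝒢.s q.1, q.2) ∈ φ.1.target →
      φ.1.symm (𝒢.s q.1, q.2) ∈ φ'.source →
      φ'.symm (𝒢.s q.1, coordRep φ.1 φ' id (𝒢.s q.1) q.2) = φ.1.symm (𝒢.s q.1, q.2) :=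
    fun q hq hq' => Φ.2.1.symm_mk_snd hq' (φ.2.1.proj_symm hq)
  have h2 := (ckZeroOn_actRep_of_mem_atlas hφ' hψ' n).comp (q := fun g => g) hV h1
    (by fun_prop) (by
      rintro q ⟨⟨-, hq1⟩, hq2, hq3⟩
      refine ⟨Φ.2.1.mk_snd_mem hq3 (φ.2.1.proj_symm hq2), ?_⟩
      change S.smul q.1 (φ'.symm (𝒢.s q.1, coordRep φ.1 φ' id (𝒢.s q.1) q.2)) ∈ ψ'.source
      rw [hsymm q hq2 hq3]
      exact hq1.2)
  have hrep : ∀ q : G × Model S.fam.dim, (𝒢.s q.1, q.2) ∈ φ.1.target →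
      φ.1.symm (𝒢.s q.1, q.2) ∈ φ'.source →
      S.actRep φ' ψ' q.1 (coordRep φ.1 φ' id (𝒢.s q.1) q.2) = S.actRep φ.1 ψ' q.1 q.2 := by
    intro q hq hq'
    rw [actRep, hsymm q hq hq', actRep]
  have h3 := ((ψ.2.2 ψ' hψ').2.ckZeroOn
    (ψ'.isOpen_inter_preimage_symm (ψ.1.open_source)) n).comp (q := 𝒢.r) hV h2
    (by fun_prop) (by
      rintro q ⟨⟨hq0, hq1⟩, hq2, hq3⟩
      rw [hrep q hq2 hq3]
      refine ⟨actRep_mem_target (ψ := Ψ) hq1, ?_⟩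
      change ψ'.symm (𝒢.r q.1, S.actRep φ.1 ψ' q.1 q.2) ∈ ψ.1.source
      rw [symm_actRep (ψ := Ψ) hq1]
      exact hq0.2)
  refine h3.congr hV ?_
  rintro q ⟨⟨hq0, hq1⟩, hq2, hq3⟩
  change _ = (ψ.1 (ψ'.symm (𝒢.r q.1,
    S.actRep φ' ψ' q.1 (coordRep φ.1 φ' id (𝒢.s q.1) q.2)))).2
  rw [hrep q hq2 hq3, symm_actRep (ψ := Ψ) hq1, actRep]

section

variable {φ ψ χ : S.Chart} {g g₁ g₂ : G} {w : Model S.fam.dim}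

theorem differentiableAt_actRep (h : (g, w) ∈ S.actDom φ.1 ψ.1) :
    DifferentiableAt ℝ (S.actRep φ.1 ψ.1 g) w :=
  (ckZeroOn_actRep φ ψ 1).2.1 (g, w) h

/-- The cocycle identity of Jacobians: chain rule and multiplicativity of the determinant. -/
theorem jac_mul_jac (h : (g₂, w) ∈ S.actDom φ.1 ψ.1) (e : 𝒢.s g₁ = 𝒢.r g₂)
    (h' : (𝒢.prod g₁ g₂, w) ∈ S.actDom φ.1 χ.1) :
    S.jac ψ.1 χ.1 g₁ (S.actRep φ.1 ψ.1 g₂ w) * S.jac φ.1 ψ.1 g₂ w =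
      S.jac φ.1 χ.1 (𝒢.prod g₁ g₂) w := by
  have h1 : S.actRep φ.1 χ.1 (𝒢.prod g₁ g₂) =ᶠ[𝓝 w]
      S.actRep ψ.1 χ.1 g₁ ∘ S.actRep φ.1 ψ.1 g₂ := by
    filter_upwards [slice_mem_nhds (isOpen_actDom φ ψ) h] with w' hw'
    exact (actRep_actRep hw' e).symm
  rw [jac, jac, jac, h1.fderiv_eq, fderiv_comp w
    (differentiableAt_actRep ((mem_actDom_prod_iff h e).2 h')) (differentiableAt_actRep h),
    ← abs_mul, ContinuousLinearMap.det, ContinuousLinearMap.det, ContinuousLinearMap.det,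
    ContinuousLinearMap.toLinearMap_comp, LinearMap.det_comp]

theorem jac_unit_self {u : B} (h : (u, w) ∈ φ.1.target) : S.jac φ.1 φ.1 (𝒢.unit u) w = 1 := by
  have h1 : S.actRep φ.1 φ.1 (𝒢.unit u) =ᶠ[𝓝 w] fun w' => w' := by
    filter_upwards [slice_mem_nhds φ.1.open_target h] with w' hw' using actRep_unit_self hw'
  rw [jac, h1.fderiv_eq, fderiv_fun_id, ContinuousLinearMap.det]
  simp

/-- By the cocycle identity the Jacobians of g and g⁻¹ multiply to that of a unit, which is 1. -/
theorem jac_pos (h : (g, w) ∈ S.actDom φ.1 ψ.1) : 0 < S.jac φ.1 ψ.1 g w := by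
  have h1 := jac_mul_jac (χ := φ) h (𝒢.s_inv g)
    ((mem_actDom_prod_iff h (𝒢.s_inv g)).1 (inv_mem_actDom h))
  rw [inv_prod_self, jac_unit_self h.1] at h1
  refine lt_of_le_of_ne (abs_nonneg _) fun h0 => ?_
  change 0 = S.jac φ.1 ψ.1 g w at h0
  rw [← h0, mul_zero] at h1
  exact zero_ne_one h1

end

theorem ckZeroOn_jac (φ ψ : S.Chart) (n : ℕ) :
    CkZeroOn n (S.actDom φ.1 ψ.1) (S.jac φ.1 ψ.1) :=
  (ckZeroOn_actRep φ ψ (n + 1)).2.2.contDiffOn_comp isOpen_det_ne_zero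
    (contDiffOn_abs_det (n := n)) (isOpen_actDom φ ψ) fun _ hq => abs_pos.1 (jac_pos hq)

end CInfZeroSpace

end Action

end CFam

/-! ### Invariant densities and the measures they define -/

namespace CFam

theorem _root_.ContinuousOn.measurableSet_inter_preimage {X Y : Type*} [TopologicalSpace X]
    [MeasurableSpace X] [OpensMeasurableSpace X] [TopologicalSpace Y] [MeasurableSpace Y]
    [BorelSpace Y] {f : X → Y} {s : Set X} (hf : ContinuousOn f s) (hs : MeasurableSet s)
    {t : Set Y} (ht : MeasurableSet t) : MeasurableSet (s ∩ f ⁻¹' t) := by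
  have h := (continuousOn_iff_continuous_domRestrict.1 hf).measurable ht
  have h2 := hs.subtype_image h
  convert h2 using 1
  ext x
  constructor
  · rintro ⟨h1, h2⟩
    exact ⟨⟨x, h1⟩, h2, rfl⟩
  · rintro ⟨⟨x, h1⟩, h2, rfl⟩
    exact ⟨h1, h2⟩

namespace CInfZeroSpace

section Density

variable {G B X : Type*} [TopologicalSpace G] [TopologicalSpace B] [TopologicalSpace X]
  {𝒢 : ContinuousFamilyGroupoid G B} {S : CInfZeroSpace 𝒢 X}

/-- `d` gives the coefficients in the charts of an invariant nonnegative `1`-density along the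
fibers, of class `C^{N,0}`. -/
structure IsDensity (S : CInfZeroSpace 𝒢 X) (N : ℕ∞) (d : S.Chart → B → Model S.fam.dim → ℝ) :
    Prop where
  nonneg : ∀ φ : S.Chart, ∀ v ∈ φ.1.target, 0 ≤ d φ v.1 v.2
  equivariant : ∀ (φ ψ : S.Chart) (g : G) (w : Model S.fam.dim), (g, w) ∈ S.actDom φ.1 ψ.1 →
    d ψ (𝒢.r g) (S.actRep φ.1 ψ.1 g w) * S.jac φ.1 ψ.1 g w = d φ (𝒢.s g) w
  ckZeroOn : ∀ n : ℕ, (n : ℕ∞) ≤ N → ∀ φ : S.Chart, CkZeroOn n φ.1.target (d φ)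

variable {N : ℕ∞} {d : S.Chart → B → Model S.fam.dim → ℝ}

theorem IsDensity.continuousOn (hd : S.IsDensity N d) (φ : S.Chart) :
    ContinuousOn (fun v => d φ v.1 v.2) φ.1.target :=
  hd.ckZeroOn 0 (by simp) φ

theorem exists_countable_charts [SecondCountableTopology X] [Nonempty X] (S : CInfZeroSpace 𝒢 X) :
    ∃ e : ℕ → S.Chart, ∀ x, ∃ n, x ∈ (e n).1.source := by
  choose c hc hxc using S.fam.cover
  obtain ⟨s, hs, hsu⟩ := TopologicalSpace.countable_cover_nhds
    (f := fun x => (c x).source) fun x => (c x).open_source.mem_nhds (hxc x)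
  have hne : s.Nonempty := by
    by_contra h
    rw [not_nonempty_iff_eq_empty] at h
    exact empty_ne_univ (by simpa [h] using hsu)
  obtain ⟨f, rfl⟩ := hs.exists_eq_range hne
  refine ⟨fun n => ⟨c (f n), S.fam.isChart_of_mem_atlas (hc _)⟩, fun x => ?_⟩
  have hx : x ∈ ⋃ x ∈ range f, (c x).source := by rw [hsu]; trivial
  simpa using hx

set_option linter.unusedSectionVars false

variable [MeasurableSpace X]

/-- The measure on the part of the fiber over `u` in the domain of `φ` that has density `d φ u` in
the coordinates. -/
noncomputable def chartPush (d : S.Chart → B → Model S.fam.dim → ℝ) (φ : S.Chart) (u : B) :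
    Measure X :=
  ((volume.restrict (slice φ.1.target u)).withDensity fun w => ENNReal.ofReal (d φ u w)).map
    fun w => φ.1.symm (u, w)

theorem continuousOn_smul_fibre (g : G) : ContinuousOn (S.smul g) {x | S.p x = 𝒢.s g} :=
  continuousOn_smul.comp (f := fun x => (g, x)) (by fun_prop) fun _ hx => Eq.symm hx

theorem continuousOn_symm_slice (φ : S.Chart) (u : B) :
    ContinuousOn (fun w => φ.1.symm (u, w)) (slice φ.1.target u) :=
  φ.1.continuousOn_symm.comp (f := fun w : Model S.fam.dim => (u, w)) (by fun_prop)
    fun _ hw => hw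

variable [BorelSpace X]

theorem aemeasurable_symm (d : S.Chart → B → Model S.fam.dim → ℝ) (φ : S.Chart) (u : B) :
    AEMeasurable (fun w => φ.1.symm (u, w))
      ((volume.restrict (slice φ.1.target u)).withDensity fun w => ENNReal.ofReal (d φ u w)) :=
  ((continuousOn_symm_slice φ u).aemeasurable
    (isOpen_slice φ.1.open_target u).measurableSet).mono_ac (withDensity_absolutelyContinuous _ _)

theorem chartPush_apply (φ : S.Chart) (u : B) {E : Set X} (hE : MeasurableSet E) :
    chartPush d φ u E = ∫⁻ w in slice φ.1.target u ∩ (fun w => φ.1.symm (u, w)) ⁻¹' E,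
      ENNReal.ofReal (d φ u w) := by
  rw [chartPush, Measure.map_apply_of_aemeasurable (aemeasurable_symm d φ u) hE, withDensity_apply',
    Measure.restrict_restrict' (isOpen_slice φ.1.open_target u).measurableSet, inter_comm]

theorem chartPush_apply_inter_source (φ : S.Chart) (u : B) {E : Set X} (hE : MeasurableSet E) :
    chartPush d φ u (E ∩ φ.1.source) = chartPush d φ u E := by
  rw [chartPush_apply φ u (hE.inter φ.1.open_source.measurableSet), chartPush_apply φ u hE]
  congr 2
  ext w
  constructor
  · rintro ⟨h1, h2, -⟩
    exact ⟨h1, h2⟩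
  · rintro ⟨h1, h2⟩
    exact ⟨h1, h2, φ.1.map_target h1⟩

/-- Change of variables along x ↦ gx in the charts φ and ψ: the Jacobian factor it produces is
absorbed by equivariance of d. This one computation yields both independence of the chart and
invariance of the measures. -/
theorem chartPush_preimage (hd : S.IsDensity N d) {φ ψ : S.Chart} {g : G} {E E' : Set X}
    (hE : MeasurableSet E) (hE' : MeasurableSet E') (h : E ⊆ ψ.1.source)
    (hEE' : ∀ x, S.p x = 𝒢.s g → (x ∈ E' ↔ S.smul g x ∈ E))
    (h' : ∀ x ∈ E', S.p x = 𝒢.s g → x ∈ φ.1.source) :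
    chartPush d φ (𝒢.s g) E' = chartPush d ψ (𝒢.r g) E := by
  rw [chartPush_apply φ _ hE', chartPush_apply ψ _ hE]
  set A := slice φ.1.target (𝒢.s g) ∩ (fun w => φ.1.symm (𝒢.s g, w)) ⁻¹' E' with hA
  have hAm : MeasurableSet A := (continuousOn_symm_slice φ _).measurableSet_inter_preimage
    (isOpen_slice φ.1.open_target _).measurableSet hE'
  have hdom : ∀ w ∈ A, (g, w) ∈ S.actDom φ.1 ψ.1 := fun w hw =>
    ⟨hw.1, h ((hEE' _ (φ.2.1.proj_symm hw.1)).1 hw.2)⟩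
  -- A point of E on the fiber over r(g) is the image of its translate by g⁻¹, which lies in E' and
  -- hence in the domain of φ.
  have himg : slice ψ.1.target (𝒢.r g) ∩ (fun w => ψ.1.symm (𝒢.r g, w)) ⁻¹' E =
      S.actRep φ.1 ψ.1 g '' A := by
    ext z
    constructor
    · rintro ⟨hz1, hz2⟩
      have hpz : 𝒢.r g = S.p (ψ.1.symm (𝒢.r g, z)) := (ψ.2.1.proj_symm hz1).symm
      have e : 𝒢.s (𝒢.inv g) = S.p (ψ.1.symm (𝒢.r g, z)) := (𝒢.s_inv g).trans hpz
      set x := S.smul (𝒢.inv g) (ψ.1.symm (𝒢.r g, z)) with hx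
      have hpx : S.p x = 𝒢.s g := (p_smul e).trans (𝒢.r_inv g)
      have hgx : S.smul g x = ψ.1.symm (𝒢.r g, z) := smul_inv_smul hpz
      have hxE : x ∈ E' := (hEE' x hpx).2 (by rw [hgx]; exact hz2)
      have hxs := h' x hxE hpx
      refine ⟨(φ.1 x).2, ⟨φ.2.1.mk_snd_mem hxs hpx, ?_⟩, ?_⟩
      · change φ.1.symm (𝒢.s g, (φ.1 x).2) ∈ E'
        rwa [φ.2.1.symm_mk_snd hxs hpx]
      · rw [actRep, φ.2.1.symm_mk_snd hxs hpx, hgx, ψ.1.right_inv hz1]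
    · rintro ⟨w, hw, rfl⟩
      refine ⟨actRep_mem_target (hdom w hw), ?_⟩
      change ψ.1.symm (𝒢.r g, S.actRep φ.1 ψ.1 g w) ∈ E
      rw [symm_actRep (hdom w hw)]
      exact (hEE' _ (φ.2.1.proj_symm hw.1)).1 hw.2
  rw [himg, lintegral_image_eq_lintegral_abs_det_fderiv_mul volume hAm
    (fun w hw => (differentiableAt_actRep (hdom w hw)).hasFDerivAt.hasFDerivWithinAt)]
  · refine setLIntegral_congr_fun hAm fun w hw => ?_
    change ENNReal.ofReal (d φ (𝒢.s g) w) = ENNReal.ofReal (S.jac φ.1 ψ.1 g w) * _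
    rw [← ENNReal.ofReal_mul (jac_pos (hdom w hw)).le, mul_comm, hd.equivariant φ ψ g w (hdom w hw)]
  · intro w hw w' hw' hww
    rw [← actRep_inv_actRep (hdom w hw), hww, actRep_inv_actRep (hdom w' hw')]

theorem chartPush_eq_chartPush (hd : S.IsDensity N d) {φ ψ : S.Chart} (u : B) {E : Set X}
    (hE : MeasurableSet E) (h : E ⊆ φ.1.source) (h' : E ⊆ ψ.1.source) :
    chartPush d φ u E = chartPush d ψ u E := by
  have := chartPush_preimage hd (φ := φ) (ψ := ψ) (g := 𝒢.unit u) hE hE h'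
    (fun x hx => by rw [unit_smul (hx.trans (𝒢.s_unit u))]) fun x hx _ => h hx
  rwa [𝒢.s_unit, 𝒢.r_unit] at this

/-- The measures on the fibers given by an invariant density, as measures on the total space. -/
structure IsDensityMeasure (d : S.Chart → B → Model S.fam.dim → ℝ) (M : B → Measure X) :
    Prop where
  ae_proj : ∀ u, ∀ᵐ x ∂M u, S.p x = u
  apply : ∀ (φ : S.Chart) (u : B) (E : Set X), MeasurableSet E → E ⊆ φ.1.source →
    M u E = chartPush d φ u E

variable [T2Space B]

theorem measurableSet_fibre (u : B) : MeasurableSet {x | S.p x = u} :=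
  (isClosed_eq S.fam.continuous_proj continuous_const).measurableSet

/-- Countably many chart domains are cut into disjoint Borel pieces, and on each piece the measure
of its chart is used. Agreement of the chart measures on overlaps makes the sum correct in every
chart. -/
theorem exists_isDensityMeasure [SecondCountableTopology X] (hd : S.IsDensity N d) :
    ∃ M : B → Measure X, IsDensityMeasure d M := by
  rcases isEmpty_or_nonempty X with hX | hX
  · exact ⟨fun _ => 0, by simp, fun φ u E _ _ => by
      rw [Set.eq_empty_of_isEmpty E, measure_empty, measure_empty]⟩
  obtain ⟨e, he⟩ := S.exists_countable_charts
  set D := disjointed fun n => (e n).1.source with hD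
  have hDm : ∀ n, MeasurableSet (D n) := MeasurableSet.disjointed fun n =>
    (e n).1.open_source.measurableSet
  have hDu : ⋃ n, D n = univ := by
    rw [iUnion_disjointed]
    exact eq_univ_of_forall fun x => mem_iUnion.2 (he x)
  have hDs : ∀ n, D n ⊆ (e n).1.source := disjointed_subset _
  refine ⟨fun u => Measure.sum fun n => (chartPush d (e n) u).restrict (D n), fun u => ?_, ?_⟩
  · rw [ae_iff]
    change Measure.sum (fun n => (chartPush d (e n) u).restrict (D n)) {x | S.p x = u}ᶜ = 0
    rw [Measure.sum_apply _ (measurableSet_fibre u).compl, ENNReal.tsum_eq_zero]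
    intro n
    refine le_antisymm ((Measure.restrict_apply_le _ _).trans_eq ?_) zero_le
    rw [chartPush_apply _ _ (measurableSet_fibre u).compl]
    have : slice (e n).1.target u ∩ (fun w => (e n).1.symm (u, w)) ⁻¹' {x | S.p x = u}ᶜ = ∅ := by
      rw [eq_empty_iff_forall_notMem]
      exact fun w hw => hw.2 ((e n).2.1.proj_symm hw.1)
    rw [this, Measure.restrict_empty, lintegral_zero_measure]
  · intro φ u E hE hEφ
    have h1 : ∀ n, (chartPush d (e n) u).restrict (D n) E = chartPush d φ u (E ∩ D n) := by
      intro n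
      rw [Measure.restrict_apply hE]
      exact chartPush_eq_chartPush hd u (hE.inter (hDm n)) (inter_subset_right.trans (hDs n))
        (inter_subset_left.trans hEφ)
    rw [Measure.sum_apply _ hE]
    simp only [h1]
    have hdis : Pairwise (Function.onFun Disjoint fun n => E ∩ D n) := fun i j hij =>
      (disjoint_disjointed (fun n => (e n).1.source) hij).mono inter_subset_right
        inter_subset_right
    rw [← measure_iUnion hdis fun n => hE.inter (hDm n), ← inter_iUnion, hDu, inter_univ]

namespace IsDensityMeasure

variable {M : B → Measure X}

theorem restrict_fibre (hM : IsDensityMeasure d M) (u : B) :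
    (M u).restrict {x | S.p x = u} = M u :=
  Measure.restrict_eq_self_of_ae_mem (hM.ae_proj u)

theorem measure_inter_fibre (hM : IsDensityMeasure d M) (u : B) (E : Set X) :
    M u (E ∩ {x | S.p x = u}) = M u E := by
  rw [← Measure.restrict_apply' (measurableSet_fibre u), hM.restrict_fibre]

theorem aemeasurable_smul [SecondCountableTopology X] (hM : IsDensityMeasure d M) (g : G) :
    AEMeasurable (S.smul g) (M (𝒢.s g)) := by
  rw [← hM.restrict_fibre]
  exact (continuousOn_smul_fibre g).aemeasurable (measurableSet_fibre _)

theorem measurableSet_smul_preimage [SecondCountableTopology X] (g : G) {E : Set X}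
    (hE : MeasurableSet E) : MeasurableSet ({x | S.p x = 𝒢.s g} ∩ S.smul g ⁻¹' E) :=
  (continuousOn_smul_fibre g).measurableSet_inter_preimage (measurableSet_fibre _) hE

/-- Two measures agree if they agree on the pieces of a countable cover. Here the pieces are the
sets of y in the r(g)-fiber's image of charts, chosen so that both y and g⁻¹y lie in single chart
domains; `chartPush_preimage` applies there, and the complement of the fiber is null for both. -/
theorem map_smul [SecondCountableTopology X] (hM : IsDensityMeasure d M) (hd : S.IsDensity N d)
    (g : G) : (M (𝒢.s g)).map (S.smul g) = M (𝒢.r g) := by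
  rcases isEmpty_or_nonempty X with hX | hX
  · exact Subsingleton.elim _ _
  obtain ⟨e, he⟩ := S.exists_countable_charts
  have hmap : ∀ E, MeasurableSet E → (M (𝒢.s g)).map (S.smul g) E =
      M (𝒢.s g) ({x | S.p x = 𝒢.s g} ∩ S.smul g ⁻¹' E) := by
    intro E hE
    rw [Measure.map_apply_of_aemeasurable (hM.aemeasurable_smul g) hE, inter_comm,
      hM.measure_inter_fibre]
  let V : ℕ × ℕ → Set X := fun q => (e q.1).1.source ∩
    ({y | S.p y = 𝒢.s (𝒢.inv g)} ∩ S.smul (𝒢.inv g) ⁻¹' (e q.2).1.source)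
  let V' : Option (ℕ × ℕ) → Set X := fun o => o.elim {y | S.p y = 𝒢.r g}ᶜ V
  refine (Measure.ext_iff_of_iUnion_eq_univ (s := V') ?_).2 ?_
  · refine eq_univ_of_forall fun y => mem_iUnion.2 ?_
    by_cases hy : S.p y = 𝒢.r g
    · obtain ⟨n, hn⟩ := he y
      obtain ⟨m, hm⟩ := he (S.smul (𝒢.inv g) y)
      exact ⟨some (n, m), hn, hy.trans (𝒢.s_inv g).symm, hm⟩
    · exact ⟨none, hy⟩
  · rintro (_ | ⟨n, m⟩)
    · have h1 : M (𝒢.r g) {y | S.p y = 𝒢.r g}ᶜ = 0 := hM.ae_proj _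
      have h2 : (M (𝒢.s g)).map (S.smul g) {y | S.p y = 𝒢.r g}ᶜ = 0 := by
        rw [hmap _ (measurableSet_fibre _).compl]
        convert measure_empty (μ := M (𝒢.s g))
        rw [eq_empty_iff_forall_notMem]
        exact fun x hx => hx.2 (p_smul (Eq.symm hx.1))
      change Measure.restrict _ {y | S.p y = 𝒢.r g}ᶜ = Measure.restrict _ {y | S.p y = 𝒢.r g}ᶜ
      rw [Measure.restrict_eq_zero.2 h1, Measure.restrict_eq_zero.2 h2]
    · have hV : MeasurableSet (V' (some (n, m))) :=
        (e n).1.open_source.measurableSet.inter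
          (measurableSet_smul_preimage _ (e m).1.open_source.measurableSet)
      ext E hE
      have hEV := hE.inter hV
      have hEn : E ∩ V' (some (n, m)) ⊆ (e n).1.source := fun y hy => hy.2.1
      have hEm : {x | S.p x = 𝒢.s g} ∩ S.smul g ⁻¹' (E ∩ V' (some (n, m))) ⊆
          (e m).1.source := by
        rintro x ⟨hx, hx'⟩
        have h3 : S.smul (𝒢.inv g) (S.smul g x) ∈ (e m).1.source := hx'.2.2.2
        rwa [inv_smul_smul (Eq.symm hx)] at h3
      rw [Measure.restrict_apply hE, Measure.restrict_apply hE, hmap _ hEV,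
        hM.apply (e n) _ _ hEV hEn,
        hM.apply (e m) _ _ (measurableSet_smul_preimage g hEV) hEm]
      exact chartPush_preimage hd hEV (measurableSet_smul_preimage g hEV) hEn
        (fun x hx => ⟨fun h => h.2, fun h => ⟨hx, h⟩⟩) fun x hx _ => hEm hx

end IsDensityMeasure

end Density

end CInfZeroSpace

end CFam

namespace CFam

namespace CInfZeroSpace

set_option linter.unusedSectionVars false

/-! ### From positive invariant densities to Haar systems -/

section FibreMeasure

variable {G B X : Type*} [TopologicalSpace G] [TopologicalSpace B] [TopologicalSpace X]
  {𝒢 : ContinuousFamilyGroupoid G B} {S : CInfZeroSpace 𝒢 X}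
  [MeasurableSpace X] [BorelSpace X] [T2Space B]
  {N : ℕ∞} {d : S.Chart → B → Model S.fam.dim → ℝ} {M : B → Measure X}

/-- The measures on the fibers induced by measures on the total space. -/
noncomputable def fibreMeasure (S : CInfZeroSpace 𝒢 X) (M : B → Measure X) (u : B) :
    Measure (Fibre S.p u) :=
  (M u).comap Subtype.val

theorem measurableEmbedding_fibre (u : B) :
    MeasurableEmbedding (Subtype.val : Fibre S.p u → X) :=
  MeasurableEmbedding.subtype_coe (measurableSet_fibre u)

theorem range_fibre (S : CInfZeroSpace 𝒢 X) (u : B) : range (Subtype.val : Fibre S.p u → X) = {x | S.p x = u} :=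
  Subtype.range_coe

theorem map_fibreMeasure (hM : IsDensityMeasure d M) (u : B) :
    (S.fibreMeasure M u).map Subtype.val = M u := by
  rw [fibreMeasure, (measurableEmbedding_fibre u).map_comap, range_fibre, hM.restrict_fibre]

theorem integral_fibreMeasure {E : Type*} [NormedAddCommGroup E] [NormedSpace ℝ E]
    (hM : IsDensityMeasure d M) (u : B) (f : X → E) :
    ∫ x, f x.1 ∂S.fibreMeasure M u = ∫ x, f x ∂M u := by
  rw [← map_fibreMeasure hM u, (measurableEmbedding_fibre u).integral_map]

theorem fibreMeasure_apply (u : B) (E : Set (Fibre S.p u)) :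
    S.fibreMeasure M u E = M u (Subtype.val '' E) :=
  (measurableEmbedding_fibre u).comap_apply _ _

theorem chartMeasure_fibreMeasure (hM : IsDensityMeasure d M) (φ : S.Chart) (u : B) :
    chartMeasure φ.1 u (S.fibreMeasure M u) =
      (volume.restrict (slice φ.1.target u)).withDensity fun w => ENNReal.ofReal (d φ u w) := by
  have hsm : MeasurableSet {x : Fibre S.p u | x.1 ∈ φ.1.source} :=
    measurable_subtype_coe φ.1.open_source.measurableSet
  have hc : ContinuousOn (fun x : Fibre S.p u => (φ.1 x.1).2) {x | x.1 ∈ φ.1.source} :=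
    continuous_snd.comp_continuousOn (φ.1.continuousOn.comp
      continuous_subtype_val.continuousOn fun x hx => hx)
  have hc' : ContinuousOn (fun x : X => (φ.1 x).2) φ.1.source :=
    continuous_snd.comp_continuousOn φ.1.continuousOn
  ext A hA
  have hAm := hc'.measurableSet_inter_preimage φ.1.open_source.measurableSet hA
  rw [chartMeasure, Measure.map_apply_of_aemeasurable (hc.aemeasurable hsm) hA,
    Measure.restrict_apply' hsm, fibreMeasure_apply]
  have himg : Subtype.val '' ((fun x : Fibre S.p u => (φ.1 x.1).2) ⁻¹' A ∩
      {x | x.1 ∈ φ.1.source}) = (φ.1.source ∩ (fun x => (φ.1 x).2) ⁻¹' A) ∩ {x | S.p x = u} := by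
    ext x
    constructor
    · rintro ⟨x, ⟨h1, h2⟩, rfl⟩
      exact ⟨⟨h2, h1⟩, x.2⟩
    · rintro ⟨⟨h1, h2⟩, h3⟩
      exact ⟨⟨x, h3⟩, ⟨h2, h1⟩, rfl⟩
  rw [himg, hM.measure_inter_fibre, hM.apply φ u _ hAm inter_subset_left, chartPush_apply φ u hAm,
    withDensity_apply', Measure.restrict_restrict' (isOpen_slice φ.1.open_target u).measurableSet]
  congr 2
  ext w
  constructor
  · rintro ⟨h1, h2, h3⟩
    refine ⟨?_, h1⟩
    change (φ.1 (φ.1.symm (u, w))).2 ∈ A at h3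
    rwa [φ.1.right_inv h1] at h3
  · rintro ⟨h1, h2⟩
    refine ⟨h2, φ.1.map_target h2, ?_⟩
    change (φ.1 (φ.1.symm (u, w))).2 ∈ A
    rwa [φ.1.right_inv h2]

theorem isOpenPosMeasure_fibreMeasure (hd : S.IsDensity N d)
    (hpos : ∀ φ : S.Chart, ∀ v ∈ φ.1.target, 0 < d φ v.1 v.2) (hM : IsDensityMeasure d M) (u : B) :
    (S.fibreMeasure M u).IsOpenPosMeasure := by
  refine ⟨fun O hO hne h0 => ?_⟩
  obtain ⟨x, hx⟩ := hne
  obtain ⟨O', hO', rfl⟩ := isOpen_induced_iff.1 hO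
  obtain ⟨φ', hφ', hxφ⟩ := S.fam.cover x.1
  let φ : S.Chart := ⟨φ', S.fam.isChart_of_mem_atlas hφ'⟩
  have hOm := (hO'.inter φ.1.open_source).measurableSet
  have h1 : chartPush d φ u (O' ∩ φ.1.source) = 0 := by
    rw [← hM.apply φ u _ hOm inter_subset_right, ← hM.measure_inter_fibre]
    rw [fibreMeasure_apply] at h0
    refine measure_mono_null ?_ h0
    rintro y ⟨⟨hy1, hy2⟩, hy3⟩
    exact ⟨⟨y, hy3⟩, hy1, rfl⟩
  rw [chartPush_apply φ u hOm] at h1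
  set W := slice φ.1.target u ∩ (fun w => φ.1.symm (u, w)) ⁻¹' (O' ∩ φ.1.source) with hW
  have hWo : IsOpen W := (continuousOn_symm_slice φ u).isOpen_inter_preimage
    (isOpen_slice φ.1.open_target u) (hO'.inter φ.1.open_source)
  have hcont : ContinuousOn (fun w => d φ u w) W :=
    (hd.continuousOn φ).comp (f := fun w : Model S.fam.dim => (u, w)) (by fun_prop)
      fun w hw => hw.1
  rw [lintegral_eq_zero_iff' (hcont.aemeasurable hWo.measurableSet).ennreal_ofReal] at h1
  have h2 : ∀ᵐ w ∂(volume.restrict W : Measure (Model S.fam.dim)), False := by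
    filter_upwards [h1, ae_restrict_mem hWo.measurableSet] with w hw hwW
    exact (hpos φ (u, w) hwW.1).not_ge (ENNReal.ofReal_eq_zero.1 hw)
  rw [eventually_false_iff_eq_bot, ae_eq_bot, Measure.restrict_eq_zero] at h2
  refine (hWo.measure_pos volume ⟨(φ.1 x.1).2, ?_⟩).ne' h2
  refine ⟨φ.2.1.mk_snd_mem hxφ x.2, ?_⟩
  change φ.1.symm (u, (φ.1 x.1).2) ∈ O' ∩ φ.1.source
  rw [φ.2.1.symm_mk_snd hxφ x.2]
  exact (⟨hx, hxφ⟩ : x.1 ∈ O' ∩ φ.1.source)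

/-- The continuous coefficient is bounded on a compact coordinate neighborhood. This is what makes
continuous compactly supported functions integrable in the averaging below. -/
theorem isLocallyFiniteMeasure_fibreMeasure (hd : S.IsDensity N d)
    (hM : IsDensityMeasure d M) (u : B) : IsLocallyFiniteMeasure (S.fibreMeasure M u) := by
  refine ⟨fun x => ?_⟩
  obtain ⟨φ', hφ', hxφ⟩ := S.fam.cover x.1
  let φ : S.Chart := ⟨φ', S.fam.isChart_of_mem_atlas hφ'⟩
  have hcont : ContinuousOn (fun w => d φ u w) (slice φ.1.target u) :=
    (hd.continuousOn φ).comp (f := fun w : Model S.fam.dim => (u, w)) (by fun_prop)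
      fun w hw => hw
  obtain ⟨K, hK, hxK, hKs⟩ := exists_compact_subset (isOpen_slice φ.1.open_target u)
    (show (φ.1 x.1).2 ∈ slice φ.1.target u from φ.2.1.mk_snd_mem hxφ x.2)
  obtain ⟨C, hC⟩ := hK.exists_bound_of_continuousOn (hcont.mono hKs)
  have hc' : ContinuousOn (fun x : X => (φ.1 x).2) φ.1.source :=
    continuous_snd.comp_continuousOn φ.1.continuousOn
  have hOo := hc'.isOpen_inter_preimage φ.1.open_source (isOpen_interior (s := K))
  refine ⟨Subtype.val ⁻¹' (φ.1.source ∩ (fun x : X => (φ.1 x).2) ⁻¹' interior K),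
    (hOo.preimage continuous_subtype_val).mem_nhds ⟨hxφ, hxK⟩, ?_⟩
  rw [fibreMeasure_apply]
  refine (measure_mono (image_preimage_subset _ _)).trans_lt ?_
  rw [hM.apply φ u _ hOo.measurableSet inter_subset_left, chartPush_apply φ u hOo.measurableSet]
  calc _ ≤ ∫⁻ w in K, ENNReal.ofReal (d φ u w) := by
        refine lintegral_mono_set fun w hw => ?_
        have h2 := hw.2.2
        change (φ.1 (φ.1.symm (u, w))).2 ∈ interior K at h2
        rw [φ.1.right_inv hw.1] at h2
        exact interior_subset h2
    _ ≤ ∫⁻ _ in K, ENNReal.ofReal C := by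
        refine setLIntegral_mono' hK.measurableSet fun w hw => ?_
        exact ENNReal.ofReal_le_ofReal ((le_abs_self _).trans (hC w hw))
    _ < ⊤ := by
        rw [setLIntegral_const]
        exact ENNReal.mul_lt_top ENNReal.ofReal_lt_top hK.measure_lt_top

/-- As `Chart` runs through the maximal atlas, the coefficient d φ itself serves as Radon-Nikodym
derivative, and invariance of integrals is `map_smul`. -/
theorem isCInfZeroHaarSystem_fibreMeasure [SecondCountableTopology X] (hd : S.IsDensity ⊤ d)
    (hpos : ∀ φ : S.Chart, ∀ v ∈ φ.1.target, 0 < d φ v.1 v.2) (hM : IsDensityMeasure d M) :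
    IsCInfZeroHaarSystem S (S.fibreMeasure M) where
  support_eq u := by
    have := isOpenPosMeasure_fibreMeasure hd hpos hM u
    exact Measure.support_eq_univ
  density φ hφ := by
    have hφM := chartMeasure_fibreMeasure hM ⟨φ, hφ⟩
    refine ⟨fun u => ?_, d ⟨φ, hφ⟩, cInfZeroOn_of_ckZeroOn φ.open_target
      (fun n => hd.ckZeroOn n le_top ⟨φ, hφ⟩), fun u w hw => hpos ⟨φ, hφ⟩ (u, w) hw, hφM⟩
    rw [hφM u]
    refine ⟨withDensity_absolutelyContinuous _ _, withDensity_absolutelyContinuous' ?_ ?_⟩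
    · refine AEMeasurable.ennreal_ofReal (ContinuousOn.aemeasurable ?_
        (isOpen_slice φ.open_target u).measurableSet)
      exact (hd.continuousOn ⟨φ, hφ⟩).comp (f := fun w : Model S.fam.dim => (u, w)) (by fun_prop)
        fun w hw => hw
    · filter_upwards [ae_restrict_mem (isOpen_slice φ.open_target u).measurableSet] with w hw
      exact (ENNReal.ofReal_pos.2 (hpos ⟨φ, hφ⟩ (u, w) hw)).ne'
  invariant g f hf _ := by
    have h1 : (fun x : Fibre S.p (𝒢.s g) => f (S.act g x.1 x.2.symm)) =
        fun x => (fun y => f (S.smul g y)) x.1 := by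
      funext x
      exact congrArg f (smul_eq x.2.symm).symm
    rw [h1, integral_fibreMeasure hM (𝒢.s g) fun y => f (S.smul g y), integral_fibreMeasure hM,
      ← hM.map_smul hd g, integral_map (hM.aemeasurable_smul g) hf.aestronglyMeasurable]

end FibreMeasure

end CInfZeroSpace

end CFam

/-! ### Weighted sums of densities -/

namespace CFam

theorem exists_seq_compact_mem_nhds {Y : Type*} [TopologicalSpace Y] [LocallyCompactSpace Y]
    [SecondCountableTopology Y] {O : Set Y} (hO : IsOpen O) :
    ∃ K : ℕ → Set Y, (∀ l, IsCompact (K l) ∧ K l ⊆ O) ∧ ∀ y ∈ O, ∃ l, K l ∈ 𝓝 y := by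
  rcases O.eq_empty_or_nonempty with rfl | hne
  · exact ⟨fun _ => ∅, by simp, by simp⟩
  have h : ∀ y : Y, ∃ K : Set Y, y ∈ O → IsCompact K ∧ y ∈ interior K ∧ K ⊆ O := fun y => by
    by_cases hy : y ∈ O
    · obtain ⟨K, hK⟩ := exists_compact_subset hO hy
      exact ⟨K, fun _ => hK⟩
    · exact ⟨∅, fun h => (hy h).elim⟩
  choose K hK using h
  obtain ⟨t, htO, htc, hcov⟩ := TopologicalSpace.countable_cover_nhdsWithin
    (f := fun y => interior (K y)) (s := O) fun y hy =>
      mem_nhdsWithin_of_mem_nhds (isOpen_interior.mem_nhds (hK y hy).2.1)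
  have htne : t.Nonempty := by
    obtain ⟨y, hy⟩ := hne
    obtain ⟨z, hz, -⟩ := mem_iUnion₂.1 (hcov hy)
    exact ⟨z, hz⟩
  obtain ⟨f, rfl⟩ := htc.exists_eq_range htne
  refine ⟨fun l => K (f l), fun l => ?_, fun y hy => ?_⟩
  · have := hK (f l) (htO (mem_range_self l))
    exact ⟨this.1, this.2.2⟩
  · obtain ⟨z, ⟨l, rfl⟩, hz⟩ := mem_iUnion₂.1 (hcov hy)
    exact ⟨l, mem_interior_iff_mem_nhds.1 hz⟩

/-- Countably many sequences of functions of class `C^{N,0}` are summable in this class after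
multiplication by small enough positive weights. -/
theorem exists_weights {T : Type*} [TopologicalSpace T] {E : Type} [NormedAddCommGroup E]
    [NormedSpace ℝ E] [LocallyCompactSpace (T × E)] [SecondCountableTopology (T × E)] (N : ℕ∞)
    {O : ℕ → Set (T × E)} (hO : ∀ j, IsOpen (O j)) {f : ℕ → ℕ → T → E → ℝ}
    (hf : ∀ i j, ∀ m : ℕ, (m : ℕ∞) ≤ N → CkZeroOn m (O j) (f i j)) :
    ∃ ε : ℕ → ℝ, (∀ i, 0 < ε i) ∧ ∀ j,
      (∀ m : ℕ, (m : ℕ∞) ≤ N → CkZeroOn m (O j) fun t w => ∑' i, ε i * f i j t w) ∧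
      ∀ p ∈ O j, Summable fun i => ε i * f i j p.1 p.2 := by
  choose K hK hKn using fun j => exists_seq_compact_mem_nhds (hO j)
  have hC : ∀ i j l m : ℕ, ∃ C : ℝ, (m : ℕ∞) ≤ N →
      ∀ p ∈ K j l, ‖iteratedFDeriv ℝ m (f i j p.1) p.2‖ ≤ C := by
    intro i j l m
    by_cases hm : (m : ℕ∞) ≤ N
    · obtain ⟨C, hC⟩ := (hK j l).1.exists_bound_of_continuousOn
        ((hf i j m hm).continuousOn_iteratedFDeriv.mono (hK j l).2)
      exact ⟨C, fun _ => hC⟩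
    · exact ⟨0, fun h => (hm h).elim⟩
  choose C hC using hC
  -- Diagonal choice: A i dominates the bounds for all indices j, l, m ≤ i. For fixed j, l, m the
  -- terms ε i * |C i j l m| are then at most 2⁻ⁱ once i is large, and one weight sequence serves
  -- all sets, compacta and orders.
  let A : ℕ → ℝ := fun i => ∑ j ∈ Finset.range (i + 1), ∑ l ∈ Finset.range (i + 1),
    ∑ m ∈ Finset.range (i + 1), |C i j l m|
  have hA0 : ∀ i, 0 ≤ A i := fun i => by positivity
  have hA : ∀ i j l m, j ≤ i → l ≤ i → m ≤ i → |C i j l m| ≤ A i := by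
    intro i j l m hj hl hm
    calc |C i j l m| ≤ ∑ m ∈ Finset.range (i + 1), |C i j l m| :=
          Finset.single_le_sum (f := fun m => |C i j l m|) (fun _ _ => abs_nonneg _)
            (Finset.mem_range.2 (by omega))
      _ ≤ ∑ l ∈ Finset.range (i + 1), ∑ m ∈ Finset.range (i + 1), |C i j l m| :=
          Finset.single_le_sum (f := fun l => ∑ m ∈ Finset.range (i + 1), |C i j l m|)
            (fun _ _ => by positivity) (Finset.mem_range.2 (by omega))
      _ ≤ A i := Finset.single_le_sum (f := fun j => ∑ l ∈ Finset.range (i + 1),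
            ∑ m ∈ Finset.range (i + 1), |C i j l m|)
            (fun _ _ => by positivity) (Finset.mem_range.2 (by omega))
  let ε : ℕ → ℝ := fun i => (1 / 2) ^ i / (1 + A i)
  have hε : ∀ i, 0 < ε i := fun i => by have := hA0 i; positivity
  have hsum : ∀ j l m, Summable fun i => ε i * |C i j l m| := by
    intro j l m
    refine Summable.of_norm_bounded_eventually_nat summable_geometric_two ?_
    filter_upwards [eventually_ge_atTop (max j (max l m))] with i hi
    have h1 := hA i j l m (by omega) (by omega) (by omega)
    have h2 := hA0 i
    rw [Real.norm_of_nonneg (mul_nonneg (hε i).le (abs_nonneg _)), div_mul_eq_mul_div,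
      div_le_iff₀ (by positivity)]
    gcongr
    linarith
  have hck : ∀ i j, ∀ m : ℕ, (m : ℕ∞) ≤ N → CkZeroOn m (O j) fun t w => ε i * f i j t w :=
    fun i j m hm => (CkZeroOn.const (a := fun _ => ε i) continuousOn_const).mul (hO j) (hf i j m hm)
  have hbound : ∀ i j l, ∀ m : ℕ, (m : ℕ∞) ≤ N → ∀ p ∈ K j l,
      ‖iteratedFDeriv ℝ m (fun w => ε i * f i j p.1 w) p.2‖ ≤ ε i * |C i j l m| := by
    intro i j l m hm p hp
    have hcd : ContDiffAt ℝ m (f i j p.1) p.2 := ((hf i j m hm).contDiffOn (hO j) p.1).contDiffAt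
      ((isOpen_slice (hO j) p.1).mem_nhds ((hK j l).2 hp))
    have h1 : iteratedFDeriv ℝ m (fun w => ε i * f i j p.1 w) p.2 =
        ε i • iteratedFDeriv ℝ m (f i j p.1) p.2 := iteratedFDeriv_const_smul_apply (a := ε i) hcd
    rw [h1, norm_smul, Real.norm_of_nonneg (hε i).le]
    exact mul_le_mul_of_nonneg_left ((hC i j l m hm p hp).trans (le_abs_self _)) (hε i).le
  refine ⟨ε, hε, fun j => ⟨fun m hm => ?_, fun p hp => ?_⟩⟩
  · refine CkZeroOn.tsum (fun i => hck i j m hm) (fun p hp => ?_) (hO j)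
    obtain ⟨l, hl⟩ := hKn j p hp
    exact ⟨K j l, hl, fun m' hm' => ⟨_, hsum j l m', fun i q hq =>
      hbound i j l m' (le_trans (by exact_mod_cast hm') hm) q hq⟩⟩
  · obtain ⟨l, hl⟩ := hKn j p hp
    refine Summable.of_norm_bounded (hsum j l 0) fun i => ?_
    simpa using hbound i j l 0 (by simp) p (mem_of_mem_nhds hl)

namespace CInfZeroSpace

variable {G B X : Type*} [TopologicalSpace G] [TopologicalSpace B] [TopologicalSpace X]
  {𝒢 : ContinuousFamilyGroupoid G B} {S : CInfZeroSpace 𝒢 X}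
  {N : ℕ∞}

/-- Equivariance under a unit is the usual transformation rule of a 1-density under change of
charts. -/
theorem transition_of_equivariant {d : S.Chart → B → Model S.fam.dim → ℝ}
    (hd : ∀ (φ ψ : S.Chart) (g : G) (w : Model S.fam.dim), (g, w) ∈ S.actDom φ.1 ψ.1 →
      d ψ (𝒢.r g) (S.actRep φ.1 ψ.1 g w) * S.jac φ.1 ψ.1 g w = d φ (𝒢.s g) w)
    {φ ψ : S.Chart} {u : B} {w : Model S.fam.dim} (h : (𝒢.unit u, w) ∈ S.actDom φ.1 ψ.1) :
    d ψ u (S.actRep φ.1 ψ.1 (𝒢.unit u) w) * S.jac φ.1 ψ.1 (𝒢.unit u) w = d φ u w := by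
  have := hd φ ψ (𝒢.unit u) w h
  rwa [𝒢.r_unit, 𝒢.s_unit] at this

/-- Positivity is an open condition, so by second countability countably many of the given densities
suffice. Weights are chosen for countably many charts covering X; the transformation rule carries
positivity and regularity of the sum to all other charts. -/
theorem exists_isDensity_pos [LocallyCompactSpace B] [SecondCountableTopology B]
    [SecondCountableTopology X]
    (hex : ∀ x, ∃ d : S.Chart → B → Model S.fam.dim → ℝ, S.IsDensity N d ∧
      ∃ φ : S.Chart, x ∈ φ.1.source ∧ 0 < d φ (S.p x) (φ.1 x).2) :
    ∃ d' : S.Chart → B → Model S.fam.dim → ℝ, S.IsDensity N d' ∧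
      ∀ φ : S.Chart, ∀ v ∈ φ.1.target, 0 < d' φ v.1 v.2 := by
  rcases isEmpty_or_nonempty X with hX | hX
  -- The case X = ∅ is separate because sequences of charts and of points are chosen below; since p
  -- is surjective, B and G are empty too.
  · have hB : IsEmpty B := ⟨fun u => hX.elim (S.fam.surjective_proj u).choose⟩
    have hG : IsEmpty G := ⟨fun g => hB.elim (𝒢.r g)⟩
    have hT : ∀ φ : S.Chart, φ.1.target = ∅ := fun φ => Set.eq_empty_of_isEmpty _
    refine ⟨fun _ _ _ => 1, ⟨fun φ v => (hB.elim v.1), fun φ ψ g => hG.elim g, ?_⟩,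
      fun φ v => hB.elim v.1⟩
    intro n hn φ
    exact CkZeroOn.of_local fun p _ => hB.elim p.1
  choose D hD hDpos using hex
  obtain ⟨f, hf⟩ : ∃ f : ℕ → X, ∀ x, ∃ i, ∃ φ : S.Chart, x ∈ φ.1.source ∧
      0 < D (f i) φ (S.p x) (φ.1 x).2 := by
    choose c hc hcpos using hDpos
    have hp := S.fam.continuous_proj
    have hO : ∀ x, {y ∈ (c x).1.source | 0 < D x (c x) (S.p y) ((c x).1 y).2} ∈ 𝓝 x := by
      intro x
      have h1 : ContinuousOn (fun y => D x (c x) (S.p y) ((c x).1 y).2) (c x).1.source :=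
        ((hD x).continuousOn (c x)).comp (f := fun y => (S.p y, ((c x).1 y).2))
          (hp.continuousOn.prodMk (continuous_snd.comp_continuousOn (c x).1.continuousOn))
          fun y hy => (c x).2.1.mk_snd_mem hy rfl
      exact (h1.isOpen_inter_preimage (c x).1.open_source isOpen_Ioi).mem_nhds ⟨hc x, hcpos x⟩
    obtain ⟨s, hs, hsu⟩ := TopologicalSpace.countable_cover_nhds hO
    have hne : s.Nonempty := by
      by_contra h
      rw [not_nonempty_iff_eq_empty] at h
      exact empty_ne_univ (by simpa [h] using hsu)
    obtain ⟨f, rfl⟩ := hs.exists_eq_range hne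
    refine ⟨f, fun x => ?_⟩
    have hx := eq_univ_iff_forall.1 hsu x
    obtain ⟨y, ⟨i, rfl⟩, hy⟩ := mem_iUnion₂.1 hx
    exact ⟨i, c (f i), hy.1, hy.2⟩
  let d : ℕ → S.Chart → B → Model S.fam.dim → ℝ := fun i => D (f i)
  have hd : ∀ i, S.IsDensity N (d i) := fun i => hD (f i)
  have hpos : ∀ x, ∃ i, ∃ φ : S.Chart, x ∈ φ.1.source ∧ 0 < d i φ (S.p x) (φ.1 x).2 := hf
  obtain ⟨e, he⟩ := S.exists_countable_charts
  obtain ⟨ε, hε, h⟩ := exists_weights N (fun j => (e j).1.open_target)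
    (f := fun i j => d i (e j)) fun i j m hm => (hd i).ckZeroOn m hm (e j)
  let d' : S.Chart → B → Model S.fam.dim → ℝ := fun φ u w => ∑' i, ε i * d i φ u w
  have heq : ∀ (φ ψ : S.Chart) (g : G) (w : Model S.fam.dim), (g, w) ∈ S.actDom φ.1 ψ.1 →
      d' ψ (𝒢.r g) (S.actRep φ.1 ψ.1 g w) * S.jac φ.1 ψ.1 g w = d' φ (𝒢.s g) w := by
    intro φ ψ g w hgw
    rw [← tsum_mul_right]
    simp only [mul_assoc, (hd _).equivariant φ ψ g w hgw, d']
  have hdpos : ∀ j, ∀ v ∈ (e j).1.target, 0 < d' (e j) v.1 v.2 := by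
    intro j v hv
    obtain ⟨i, φ, hx, hi⟩ := hpos ((e j).1.symm v)
    have hpx := (e j).2.1.proj_symm hv
    rw [hpx] at hi
    refine ((h j).2 v hv).tsum_pos (fun i => mul_nonneg (hε i).le ((hd i).nonneg _ v hv)) i
      (mul_pos (hε i) ?_)
    have hm : (𝒢.unit v.1, v.2) ∈ S.actDom (e j).1 φ.1 := (mem_actDom_unit hv).2 hx
    rw [← transition_of_equivariant (hd i).equivariant hm, actRep_unit hv]
    exact mul_pos hi (jac_pos hm)
  have hdpos' : ∀ φ : S.Chart, ∀ v ∈ φ.1.target, 0 < d' φ v.1 v.2 := by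
    intro φ v hv
    obtain ⟨j, hj⟩ := he (φ.1.symm v)
    have hm : (𝒢.unit v.1, v.2) ∈ S.actDom φ.1 (e j).1 := (mem_actDom_unit hv).2 hj
    rw [← transition_of_equivariant heq hm]
    have h1 := actRep_mem_target hm
    rw [𝒢.r_unit] at h1
    exact mul_pos (hdpos j _ h1) (jac_pos hm)
  refine ⟨d', ⟨fun φ v hv => (hdpos' φ v hv).le, heq, fun n hn φ => ?_⟩, hdpos'⟩
  refine CkZeroOn.of_local fun v hv => ?_
  obtain ⟨j, hj⟩ := he (φ.1.symm v)
  have hu := 𝒢.continuous_unit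
  have hVo : IsOpen {v : B × Model S.fam.dim | (𝒢.unit v.1, v.2) ∈ S.actDom φ.1 (e j).1} :=
    (isOpen_actDom φ (e j)).preimage
      (f := fun v : B × Model S.fam.dim => (𝒢.unit v.1, v.2)) (by fun_prop)
  refine ⟨_, hVo, (mem_actDom_unit hv).2 hj, ?_⟩
  have h1 := (ckZeroOn_actRep φ (e j) n).comp_base (q := 𝒢.unit) hVo (by fun_prop) fun v hv => hv
  have h2 := (ckZeroOn_jac φ (e j) n).comp_base (q := 𝒢.unit) hVo (by fun_prop) fun v hv => hv
  have h3 := ((h j).1 n hn).comp (q := fun u => u) hVo h1 (by fun_prop) fun v hv => by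
    have := actRep_mem_target hv
    rwa [𝒢.r_unit] at this
  exact (h3.mul hVo h2).congr hVo fun v hv => (transition_of_equivariant heq hv).symm

end CInfZeroSpace

end CFam

/-! ### Translates of densities and a continuous invariant density on G -/

namespace CFam

theorem exists_continuous_bump {Y : Type*} [TopologicalSpace Y] [T2Space Y]
    [LocallyCompactSpace Y] {O : Set Y} (hO : IsOpen O) {y : Y} (hy : y ∈ O) :
    ∃ (a : C(Y, ℝ)) (C : Set Y), IsCompact C ∧ C ⊆ O ∧ (∀ v ∉ C, a v = 0) ∧ (∀ v, 0 ≤ a v) ∧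
      a y = 1 := by
  obtain ⟨C, hC, hyC, hCO⟩ := exists_compact_subset hO hy
  obtain ⟨a, ha1, ha0, -, ha⟩ := exists_continuous_one_zero_of_isCompact
    (isCompact_singleton (x := y)) (isOpen_interior (s := C)).isClosed_compl
    (by rw [disjoint_compl_right_iff_subset, singleton_subset_iff]; exact hyC)
  exact ⟨a, C, hC, hCO, fun v hv => ha0 fun h => hv (interior_subset h), fun v => (ha v).1,
    ha1 rfl⟩

namespace CInfZeroSpace

open ContinuousFamilyGroupoid

variable {G B X : Type*} [TopologicalSpace G] [TopologicalSpace B] [TopologicalSpace X]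
  {𝒢 : ContinuousFamilyGroupoid G B} {S : CInfZeroSpace 𝒢 X}

open Classical in
/-- The coefficient at `(r γ, w)` in the chart `φ` of the translate by `γ` of the density with
coefficient `β` in the chart `φ₀`. -/
noncomputable def translate (φ₀ : S.Chart) (β : B → Model S.fam.dim → ℝ) (φ : S.Chart) (γ : G)
    (w : Model S.fam.dim) : ℝ :=
  if (𝒢.inv γ, w) ∈ S.actDom φ.1 φ₀.1 then
    β (𝒢.s γ) (S.actRep φ.1 φ₀.1 (𝒢.inv γ) w) * S.jac φ.1 φ₀.1 (𝒢.inv γ) w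
  else 0

/-- Pulling the translate by gγ back along g gives the translate by γ, because (gγ)⁻¹g = γ⁻¹; the
Jacobians combine by the cocycle identity. This is the source of every equivariance statement below.
-/
theorem translate_prod (φ₀ : S.Chart) (β : B → Model S.fam.dim → ℝ) {φ ψ : S.Chart} {g γ : G}
    {w : Model S.fam.dim} (h : (g, w) ∈ S.actDom φ.1 ψ.1) (e : 𝒢.s g = 𝒢.r γ) :
    translate φ₀ β ψ (𝒢.prod g γ) (S.actRep φ.1 ψ.1 g w) * S.jac φ.1 ψ.1 g w =
      translate φ₀ β φ γ w := by
  have e1 : 𝒢.s (𝒢.inv (𝒢.prod g γ)) = 𝒢.r g := (𝒢.s_inv _).trans (r_prod e)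
  have h1 : 𝒢.prod (𝒢.inv (𝒢.prod g γ)) g = 𝒢.inv γ := by
    have e2 : 𝒢.s (𝒢.inv γ) = 𝒢.r (𝒢.inv g) := by rw [𝒢.s_inv, 𝒢.r_inv, e]
    rw [inv_prod_rev e, ← prod_assoc e2 (𝒢.s_inv g), inv_prod_self,
      prod_unit ((𝒢.s_inv γ).trans e.symm)]
  have h2 := mem_actDom_prod_iff (χ := φ₀) h e1
  have h3 := actRep_actRep (χ := φ₀) h e1
  rw [h1] at h2 h3
  by_cases h4 : (𝒢.inv γ, w) ∈ S.actDom φ.1 φ₀.1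
  · have h5 := jac_mul_jac (χ := φ₀) h e1 (by rwa [h1])
    rw [h1] at h5
    rw [translate, translate, if_pos (h2.2 h4), if_pos h4, h3, s_prod e, mul_assoc, h5]
  · rw [translate, translate, if_neg (h2.not.2 h4), if_neg h4, zero_mul]

theorem translate_nonneg (φ₀ : S.Chart) {β : B → Model S.fam.dim → ℝ} (hβ : ∀ u w, 0 ≤ β u w)
    (φ : S.Chart) (γ : G) (w : Model S.fam.dim) : 0 ≤ translate φ₀ β φ γ w := by
  rw [translate]
  split_ifs
  · exact mul_nonneg (hβ _ _) (abs_nonneg _)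
  · exact le_rfl

/-- Existence of an invariant density of class `C^{0,0}` on the groupoid. -/
theorem exists_isDensity_leftSpace [T2Space B] [LocallyCompactSpace B] [SecondCountableTopology B]
    [SecondCountableTopology G] (𝒢 : ContinuousFamilyGroupoid G B) :
    ∃ d : 𝒢.leftSpace.Chart → B → Model 𝒢.leftSpace.fam.dim → ℝ, 𝒢.leftSpace.IsDensity 0 d ∧
      ∀ φ : 𝒢.leftSpace.Chart, ∀ v ∈ φ.1.target, 0 < d φ v.1 v.2 := by
  refine exists_isDensity_pos fun x => ?_
  have hunit := 𝒢.continuous_unit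
  have hinv := 𝒢.continuous_inv
  have hs := 𝒢.continuous_s
  obtain ⟨χ', hχ', hx⟩ := 𝒢.famR.cover (𝒢.unit (𝒢.s x))
  let χ₀ : 𝒢.leftSpace.Chart := ⟨χ', 𝒢.famR.isChart_of_mem_atlas hχ'⟩
  obtain ⟨a, C, hC, hCO, haC, ha0, hax⟩ := exists_continuous_bump
    (χ₀.1.open_source.preimage hunit) (show 𝒢.s x ∈ 𝒢.unit ⁻¹' χ₀.1.source from hx)
  -- Only the value of β along the units matters, so it may be taken constant in the fiber
  -- coordinate.
  let β : B → Model 𝒢.leftSpace.fam.dim → ℝ := fun v _ => a v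
  -- The translate by y is evaluated at the point y itself, where y⁻¹y is the unit at s(y).
  let d : 𝒢.leftSpace.Chart → B → Model 𝒢.leftSpace.fam.dim → ℝ := fun χ u z =>
    translate χ₀ β χ (χ.1.symm (u, z)) z
  have hmem : ∀ (χ : 𝒢.leftSpace.Chart) (v : B × Model 𝒢.leftSpace.fam.dim), v ∈ χ.1.target →
      ((𝒢.inv (χ.1.symm v), v.2) ∈ 𝒢.leftSpace.actDom χ.1 χ₀.1 ↔
        𝒢.unit (𝒢.s (χ.1.symm v)) ∈ χ₀.1.source) := by
    intro χ v hv
    have hr : 𝒢.r (χ.1.symm v) = v.1 := χ.2.1.proj_symm hv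
    have h1 : 𝒢.leftSpace.smul (𝒢.inv (χ.1.symm v)) (χ.1.symm v) =
      𝒢.unit (𝒢.s (χ.1.symm v)) := inv_prod_self _
    simp only [actDom, mem_ofPred_eq, 𝒢.s_inv, hr, Prod.mk.eta, h1, hv, true_and]
  refine ⟨d, ⟨fun χ v hv => translate_nonneg _ (fun v _ => ha0 v) _ _ _, ?_, ?_⟩, ?_⟩
  · intro φ ψ g w h
    change translate χ₀ β ψ (ψ.1.symm (𝒢.r g, 𝒢.leftSpace.actRep φ.1 ψ.1 g w)) _ * _ = _
    rw [symm_actRep h]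
    exact translate_prod χ₀ β h (s_eq_of_mem_actDom h)
  · intro n hn χ
    obtain rfl : n = 0 := by simpa using hn
    have hy : ContinuousOn χ.1.symm χ.1.target := χ.1.continuousOn_symm
    have hyw : ContinuousOn (fun v => (𝒢.inv (χ.1.symm v), v.2)) χ.1.target :=
      (hinv.comp_continuousOn hy).prodMk continuousOn_snd
    change ContinuousOn (fun v => d χ v.1 v.2) χ.1.target
    intro v hv
    apply ContinuousAt.continuousWithinAt
    by_cases hvm : 𝒢.unit (𝒢.s (χ.1.symm v)) ∈ χ₀.1.source
    · set V := χ.1.target ∩ (fun v => (𝒢.inv (χ.1.symm v), v.2)) ⁻¹'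
        𝒢.leftSpace.actDom χ.1 χ₀.1 with hV
      have hVo : IsOpen V := hyw.isOpen_inter_preimage χ.1.open_target (isOpen_actDom χ χ₀)
      have hc : ContinuousOn (fun v => a (𝒢.s (χ.1.symm v)) *
          𝒢.leftSpace.jac χ.1 χ₀.1 (𝒢.inv (χ.1.symm v)) v.2) V := by
        refine ((a.continuous.comp hs).comp_continuousOn (hy.mono inter_subset_left)).mul ?_
        exact (ckZeroOn_jac χ χ₀ 0).continuousOn.comp (hyw.mono inter_subset_left)
          fun v hv => hv.2
      have hvV : V ∈ 𝓝 v := hVo.mem_nhds ⟨hv, (hmem χ v hv).2 hvm⟩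
      refine (hc.continuousAt hvV).congr ?_
      filter_upwards [hvV] with v' hv'
      exact (if_pos hv'.2).symm
    -- Where the formula does not apply, s(y) is outside the closed set C, and d vanishes in a whole
    -- neighborhood.
    · have hvC : 𝒢.s (χ.1.symm v) ∉ C := fun h => hvm (hCO h)
      have ho : IsOpen (χ.1.target ∩ (fun v => 𝒢.s (χ.1.symm v)) ⁻¹' Cᶜ) :=
        (hs.comp_continuousOn hy).isOpen_inter_preimage χ.1.open_target hC.isClosed.isOpen_compl
      refine (continuousAt_const (y := (0 : ℝ))).congr ?_
      filter_upwards [ho.mem_nhds ⟨hv, hvC⟩] with v' hv'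
      change 0 = translate _ _ _ _ _
      rw [translate]
      split_ifs
      · change 0 = a (𝒢.s (χ.1.symm v')) * _
        rw [haC _ hv'.2, zero_mul]
      · rfl
  · obtain ⟨χ'', hχ'', hx'⟩ := 𝒢.famR.cover x
    let χ : 𝒢.leftSpace.Chart := ⟨χ'', 𝒢.famR.isChart_of_mem_atlas hχ''⟩
    have hm := χ.2.1.mk_snd_mem hx' (t := 𝒢.r x) rfl
    have hsy : χ.1.symm (𝒢.r x, (χ.1 x).2) = x := χ.2.1.symm_mk_snd hx' rfl
    refine ⟨χ, hx', ?_⟩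
    change 0 < translate χ₀ β χ (χ.1.symm (𝒢.r x, (χ.1 x).2)) _
    have h1 := (hmem χ _ hm).2 (by rw [hsy]; exact hx)
    rw [translate, if_pos h1]
    refine mul_pos ?_ (jac_pos h1)
    change 0 < a (𝒢.s (χ.1.symm (𝒢.r x, (χ.1 x).2)))
    rw [hsy, hax]
    exact one_pos

end CInfZeroSpace

end CFam

namespace CFam

namespace CInfZeroSpace

open ContinuousFamilyGroupoid

set_option linter.unusedSectionVars false

/-! ### Integration against the measure of a density -/

section ChartIntegral

variable {G B X : Type*} [TopologicalSpace G] [TopologicalSpace B] [TopologicalSpace X]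
  {𝒢 : ContinuousFamilyGroupoid G B} {S : CInfZeroSpace 𝒢 X}
  [MeasurableSpace X] [BorelSpace X] [T2Space B] [T2Space X]
  {N : ℕ∞} {d : S.Chart → B → Model S.fam.dim → ℝ} {M : B → Measure X}

theorem IsDensityMeasure.restrict_source (hM : IsDensityMeasure d M) (χ : S.Chart) (u : B) :
    (M u).restrict χ.1.source = chartPush d χ u := by
  ext E hE
  rw [Measure.restrict_apply hE, hM.apply χ u _ (hE.inter χ.1.open_source.measurableSet)
    inter_subset_right, chartPush_apply_inter_source χ u hE]

open Classical in
theorem IsDensityMeasure.integral_eq (hM : IsDensityMeasure d M) (hd : S.IsDensity N d)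
    (χ : S.Chart) (u : B) {k : X → ℝ} (hk : AEStronglyMeasurable k (M u))
    (h0 : ∀ x ∉ χ.1.source, k x = 0) :
    ∫ x, k x ∂M u = ∫ z, if (u, z) ∈ χ.1.target then d χ u z * k (χ.1.symm (u, z)) else 0 := by
  have hsm := (isOpen_slice χ.1.open_target u).measurableSet
  have hcont : ContinuousOn (fun w => d χ u w) (slice χ.1.target u) :=
    (hd.continuousOn χ).comp (f := fun w : Model S.fam.dim => (u, w)) (by fun_prop)
      fun w hw => hw
  rw [← setIntegral_eq_integral_of_forall_compl_eq_zero h0, hM.restrict_source χ u, chartPush,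
    integral_map (aemeasurable_symm d χ u), integral_withDensity_eq_integral_toReal_smul₀
      (hcont.aemeasurable hsm).ennreal_ofReal (by simp), ← integral_indicator hsm]
  · congr 1
    funext z
    by_cases hz : (u, z) ∈ χ.1.target
    · rw [indicator_of_mem (show z ∈ slice χ.1.target u from hz), if_pos hz,
        ENNReal.toReal_ofReal (hd.nonneg χ (u, z) hz), smul_eq_mul]
    · rw [indicator_of_notMem (show z ∉ slice χ.1.target u from hz), if_neg hz]
  · have := hk.restrict (s := χ.1.source)
    rwa [hM.restrict_source χ u] at this

theorem IsDensityMeasure.aestronglyMeasurable [SecondCountableTopology X]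
    (hM : IsDensityMeasure d M) (u : B) {k : X → ℝ}
    (hk : ContinuousOn k {x | S.p x = u}) : AEStronglyMeasurable k (M u) := by
  rw [← hM.restrict_fibre u]
  exact hk.aestronglyMeasurable (measurableSet_fibre u)

theorem continuous_fibre {k : X → ℝ} {u : B} (hk : ContinuousOn k {x | S.p x = u}) :
    Continuous fun x : Fibre S.p u => k x.1 :=
  hk.comp_continuous continuous_subtype_val fun x => x.2

theorem hasCompactSupport_fibre {k : X → ℝ} {u : B} {K : Set X} (hK : IsCompact K)
    (h0 : ∀ x, S.p x = u → x ∉ K → k x = 0) :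
    HasCompactSupport fun x : Fibre S.p u => k x.1 := by
  have hc : IsClosedEmbedding (Subtype.val : Fibre S.p u → X) :=
    (isClosed_eq S.fam.continuous_proj continuous_const).isClosedEmbedding_subtypeVal
  exact HasCompactSupport.intro' (hc.isCompact_preimage hK)
    (hK.isClosed.preimage continuous_subtype_val) fun x hx => h0 x.1 x.2 hx

theorem IsDensityMeasure.integrable (hM : IsDensityMeasure d M) (hd : S.IsDensity N d) (u : B)
    {k : X → ℝ} (hk : ContinuousOn k {x | S.p x = u}) {K : Set X} (hK : IsCompact K)
    (h0 : ∀ x, S.p x = u → x ∉ K → k x = 0) : Integrable k (M u) := by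
  have := isLocallyFiniteMeasure_fibreMeasure hd hM u
  have h := (continuous_fibre hk).integrable_of_hasCompactSupport (μ := S.fibreMeasure M u)
    (hasCompactSupport_fibre hK h0)
  rw [← map_fibreMeasure hM u, (measurableEmbedding_fibre u).integrable_map_iff]
  exact h

theorem IsDensityMeasure.integral_pos (hM : IsDensityMeasure d M) (hd : S.IsDensity N d)
    (hpos : ∀ φ : S.Chart, ∀ v ∈ φ.1.target, 0 < d φ v.1 v.2) (u : B)
    {k : X → ℝ} (hk : ContinuousOn k {x | S.p x = u}) {K : Set X} (hK : IsCompact K)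
    (h0 : ∀ x, S.p x = u → x ∉ K → k x = 0) (hnn : ∀ x, 0 ≤ k x) {x : X} (hx : S.p x = u)
    (hkx : k x ≠ 0) : 0 < ∫ x, k x ∂M u := by
  have := isLocallyFiniteMeasure_fibreMeasure hd hM u
  have := isOpenPosMeasure_fibreMeasure hd hpos hM u
  rw [← integral_fibreMeasure hM u]
  exact (continuous_fibre hk).integral_pos_of_hasCompactSupport_nonneg_nonzero
    (hasCompactSupport_fibre hK h0) (fun x => hnn x.1) (x := ⟨x, hx⟩) hkx

end ChartIntegral

/-! ### Regularity and supports of translates -/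

section Average

variable {G B X : Type*} [TopologicalSpace G] [TopologicalSpace B] [TopologicalSpace X]
  {𝒢 : ContinuousFamilyGroupoid G B} {S : CInfZeroSpace 𝒢 X}

theorem isOpen_actDom_inv (φ ψ : S.Chart) :
    IsOpen {q : G × Model S.fam.dim | (𝒢.inv q.1, q.2) ∈ S.actDom φ.1 ψ.1} := by
  have hinv := 𝒢.continuous_inv
  exact (isOpen_actDom φ ψ).preimage
    (f := fun q : G × Model S.fam.dim => (𝒢.inv q.1, q.2)) (by fun_prop)

theorem isOpen_r_mem_target (φ : S.Chart) :
    IsOpen {q : G × Model S.fam.dim | (𝒢.r q.1, q.2) ∈ φ.1.target} := by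
  have hr := 𝒢.continuous_r
  exact φ.1.open_target.preimage
    (f := fun q : G × Model S.fam.dim => (𝒢.r q.1, q.2)) (by fun_prop)

theorem smul_mem_of_translate_ne_zero {φ₀ φ : S.Chart} {β : B → Model S.fam.dim → ℝ}
    {C : Set (B × Model S.fam.dim)} (hβ : ∀ v ∉ C, β v.1 v.2 = 0) {γ : G} {w : Model S.fam.dim}
    (h : translate φ₀ β φ γ w ≠ 0) :
    S.smul (𝒢.inv γ) (φ.1.symm (𝒢.r γ, w)) ∈ φ₀.1.symm '' C := by
  by_cases hm : (𝒢.inv γ, w) ∈ S.actDom φ.1 φ₀.1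
  · rw [translate, if_pos hm] at h
    have h1 : (𝒢.s γ, S.actRep φ.1 φ₀.1 (𝒢.inv γ) w) ∈ C := by
      by_contra hC
      exact h (by rw [hβ _ hC, zero_mul])
    refine ⟨_, h1, ?_⟩
    rw [← 𝒢.r_inv, symm_actRep hm, 𝒢.s_inv]
  · exact (h (if_neg hm)).elim

/-- Where γ⁻¹x is in the domain of φ₀, the defining formula is C^{n,0}. Elsewhere γ⁻¹x avoids the
image of C, which is compact and so closed in X, and the translate is zero nearby. -/
theorem ckZeroOn_translate [T2Space X] {φ₀ : S.Chart} {β : B → Model S.fam.dim → ℝ} {n : ℕ}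
    (hβ : CkZeroOn n univ β) {C : Set (B × Model S.fam.dim)} (hC : IsCompact C)
    (hCφ : C ⊆ φ₀.1.target) (hβC : ∀ v ∉ C, β v.1 v.2 = 0) (φ : S.Chart) :
    CkZeroOn n {q : G × Model S.fam.dim | (𝒢.r q.1, q.2) ∈ φ.1.target}
      (translate φ₀ β φ) := by
  have hinv := 𝒢.continuous_inv
  have hs := 𝒢.continuous_s
  have hC' : IsCompact (φ₀.1.symm '' C) := hC.image_of_continuousOn
    (φ₀.1.continuousOn_symm.mono hCφ)
  refine CkZeroOn.of_local fun q hq => ?_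
  by_cases hm : (𝒢.inv q.1, q.2) ∈ S.actDom φ.1 φ₀.1
  · refine ⟨_, isOpen_actDom_inv φ φ₀, hm, ?_⟩
    have h1 := (ckZeroOn_actRep φ φ₀ n).comp_base (q := 𝒢.inv) (isOpen_actDom_inv φ φ₀)
      (by fun_prop) fun q hq => hq
    have h2 := (ckZeroOn_jac φ φ₀ n).comp_base (q := 𝒢.inv) (isOpen_actDom_inv φ φ₀)
      (by fun_prop) fun q hq => hq
    have h3 := hβ.comp (q := 𝒢.s) (isOpen_actDom_inv φ φ₀) h1 (by fun_prop)
      fun _ _ => trivial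
    exact (h3.mul (isOpen_actDom_inv φ φ₀) h2).congr (isOpen_actDom_inv φ φ₀)
      fun q hq => if_pos hq
  · have hcont : ContinuousOn (fun q : G × Model S.fam.dim =>
        S.smul (𝒢.inv q.1) (φ.1.symm (𝒢.r q.1, q.2))) {q | (𝒢.r q.1, q.2) ∈ φ.1.target} := by
      have := (continuousOn_smul_symm φ).comp
        (f := fun q : G × Model S.fam.dim => (𝒢.inv q.1, q.2))
        (s := {q | (𝒢.r q.1, q.2) ∈ φ.1.target}) (by fun_prop) (fun q hq => by
          change (𝒢.s (𝒢.inv q.1), q.2) ∈ φ.1.target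
          rwa [𝒢.s_inv])
      simpa only [Function.comp_def, 𝒢.s_inv] using this
    have hVo := hcont.isOpen_inter_preimage (isOpen_r_mem_target φ) hC'.isClosed.isOpen_compl
    refine ⟨_, hVo, ⟨hq, fun h => hm ?_⟩, ?_⟩
    · refine ⟨by rwa [𝒢.s_inv], ?_⟩
      rw [𝒢.s_inv]
      obtain ⟨v, hv, hvq⟩ := h
      have h1 := φ₀.1.map_target (hCφ hv)
      rwa [hvq] at h1
    · refine (CkZeroOn.const (a := fun _ => (0 : ℝ)) continuousOn_const).congr hVo fun q hq => ?_
      by_contra h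
      exact hq.2 (smul_mem_of_translate_ne_zero hβC h)

/-- A nonzero value forces γ⁻¹x into the image of C, with x in the image of Y. Properness makes the
set of such pairs (γ⁻¹, x) compact; K consists of the inverses of its first coordinates. -/
theorem IsProper.exists_isCompact (hS : S.IsProper) {φ₀ φ : S.Chart}
    {β : B → Model S.fam.dim → ℝ} {C : Set (B × Model S.fam.dim)} (hC : IsCompact C)
    (hCφ : C ⊆ φ₀.1.target) (hβC : ∀ v ∉ C, β v.1 v.2 = 0) {Y : Set (B × Model S.fam.dim)}
    (hY : IsCompact Y) (hYφ : Y ⊆ φ.1.target) :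
    ∃ K : Set G, IsCompact K ∧ ∀ v ∈ Y, ∀ γ, 𝒢.r γ = v.1 → γ ∉ K →
      translate φ₀ β φ γ v.2 = 0 := by
  have hC' : IsCompact (φ₀.1.symm '' C) := hC.image_of_continuousOn
    (φ₀.1.continuousOn_symm.mono hCφ)
  have hY' : IsCompact (φ.1.symm '' Y) := hY.image_of_continuousOn
    (φ.1.continuousOn_symm.mono hYφ)
  have hK := ((hS.isCompact_preimage (hC'.prod hY')).image
    (continuous_fst.comp continuous_subtype_val)).image 𝒢.continuous_inv
  refine ⟨_, hK, fun v hv γ hγ hγK => ?_⟩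
  by_contra h
  have h1 := smul_mem_of_translate_ne_zero hβC h
  have e : 𝒢.s (𝒢.inv γ) = S.p (φ.1.symm (𝒢.r γ, v.2)) := by
    rw [φ.2.1.proj_symm (by rw [hγ]; exact hYφ hv), 𝒢.s_inv]
  refine hγK ⟨𝒢.inv γ, ⟨⟨(𝒢.inv γ, φ.1.symm (𝒢.r γ, v.2)), e⟩, ⟨?_, ?_⟩, rfl⟩, inv_inv_eq γ⟩
  · change S.act _ _ _ ∈ _
    rwa [← smul_eq]
  · exact ⟨v, hv, congrArg (fun u => φ.1.symm (u, v.2)) hγ.symm⟩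

end Average

end CInfZeroSpace

end CFam

namespace CFam

namespace CInfZeroSpace

open ContinuousFamilyGroupoid

set_option linter.unusedSectionVars false

/-! ### Averaging over the r-fibers -/

section

variable {G B X : Type*} [TopologicalSpace G] [TopologicalSpace B] [TopologicalSpace X]
  {𝒢 : ContinuousFamilyGroupoid G B}
  [T2Space G] [LocallyCompactSpace G] [SecondCountableTopology G] [MeasurableSpace G]
  [BorelSpace G] [T2Space B]
  {N : ℕ∞} {d : 𝒢.leftSpace.Chart → B → Model 𝒢.leftSpace.fam.dim → ℝ} {M : B → Measure G}

open Classical in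
/-- Integrals over the `r`-fibers of functions supported in the domain of one chart. -/
theorem ckZeroOn_integral_smul (hM : IsDensityMeasure d M) (hd : 𝒢.leftSpace.IsDensity N d)
    {E : Type} [NormedAddCommGroup E] [NormedSpace ℝ E] [LocallyCompactSpace E]
    {U : Set (B × E)} (hU : IsOpen U) {n : ℕ} {F : G → E → ℝ}
    (hF : CkZeroOn n {q : G × E | (𝒢.r q.1, q.2) ∈ U} F) (χ : 𝒢.leftSpace.Chart)
    (f : C(G, ℝ)) (hf : HasCompactSupport f) (hfχ : tsupport f ⊆ χ.1.source) :
    CkZeroOn n U fun u w => ∫ γ, f γ * F γ w ∂M u := by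
  have hr := 𝒢.continuous_r
  set C := χ.1 '' tsupport f with hCdef
  have hC : IsCompact C := hf.isCompact.image_of_continuousOn (χ.1.continuousOn.mono hfχ)
  let Φ : B × Model 𝒢.leftSpace.fam.dim → E → ℝ := fun v w => if v ∈ χ.1.target then
    d χ v.1 v.2 * (f (χ.1.symm v) * F (χ.1.symm v) w) else 0
  have hΦ0 : ∀ v ∉ C, ∀ w, Φ v w = 0 := by
    intro v hv w
    by_cases hvt : v ∈ χ.1.target
    · have : χ.1.symm v ∉ tsupport f := fun h => hv ⟨_, h, χ.1.right_inv hvt⟩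
      simp only [Φ, if_pos hvt, image_eq_zero_of_notMem_tsupport this, zero_mul, mul_zero]
    · exact if_neg hvt
  have hΦ : CkZeroOn n {p : (B × Model 𝒢.leftSpace.fam.dim) × E | (p.1.1, p.2) ∈ U} Φ := by
    have hUo : IsOpen {p : (B × Model 𝒢.leftSpace.fam.dim) × E | (p.1.1, p.2) ∈ U} :=
      hU.preimage (f := fun p : (B × Model 𝒢.leftSpace.fam.dim) × E => (p.1.1, p.2))
        (by fun_prop)
    refine CkZeroOn.of_local fun p hp => ?_
    by_cases hpt : p.1 ∈ χ.1.target
    · have hVo : IsOpen ({p : (B × Model 𝒢.leftSpace.fam.dim) × E | (p.1.1, p.2) ∈ U} ∩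
          {p | p.1 ∈ χ.1.target}) := hUo.inter (χ.1.open_target.preimage continuous_fst)
      have hsymm : ContinuousOn (fun p : (B × Model 𝒢.leftSpace.fam.dim) × E => χ.1.symm p.1)
          ({p | (p.1.1, p.2) ∈ U} ∩ {p | p.1 ∈ χ.1.target}) :=
        χ.1.continuousOn_symm.comp continuousOn_fst fun p hp => hp.2
      have h1 := hF.comp_base (q := fun v : B × Model 𝒢.leftSpace.fam.dim => χ.1.symm v) hVo
        hsymm fun p hp => by
          have h2 : 𝒢.r (χ.1.symm p.1) = p.1.1 := χ.2.1.proj_symm hp.2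
          change (𝒢.r (χ.1.symm p.1), p.2) ∈ U
          rw [h2]
          exact hp.1
      have h2 : CkZeroOn n _ fun (v : B × Model 𝒢.leftSpace.fam.dim) (_ : E) => f (χ.1.symm v) :=
        CkZeroOn.const (f.continuous.comp_continuousOn hsymm)
      -- The coefficient of the measure on G does not involve the variable in E, so its continuity
      -- suffices for every n.
      have h3 : CkZeroOn n _ fun (v : B × Model 𝒢.leftSpace.fam.dim) (_ : E) => d χ v.1 v.2 :=
        CkZeroOn.const ((hd.continuousOn χ).comp (continuousOn_fst (s :=
          ({p : (B × Model 𝒢.leftSpace.fam.dim) × E | (p.1.1, p.2) ∈ U} ∩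
            {p | p.1 ∈ χ.1.target}))) fun p hp => hp.2)
      exact ⟨_, hVo, ⟨hp, hpt⟩, (h3.mul hVo (h2.mul hVo h1)).congr hVo fun p hp => if_pos hp.2⟩
    · have hVo : IsOpen {p : (B × Model 𝒢.leftSpace.fam.dim) × E | p.1 ∈ Cᶜ} :=
        hC.isClosed.isOpen_compl.preimage continuous_fst
      refine ⟨_, hVo, ?_, (CkZeroOn.const (a := fun _ => (0 : ℝ)) continuousOn_const).congr hVo
        fun p hp => hΦ0 p.1 hp p.2⟩
      rintro ⟨x, hx, hxp⟩
      exact hpt (hxp ▸ χ.1.map_source (hfχ hx))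
  refine (CkZeroOn.integral volume hU (hC.image continuous_snd) hΦ fun p _ z hz =>
    hΦ0 _ (fun h => hz ⟨_, h, rfl⟩) _).congr hU fun p hp => ?_
  refine hM.integral_eq hd χ p.1 (hM.aestronglyMeasurable p.1 ?_) fun γ hγ => ?_
  · refine f.continuous.continuousOn.mul (hF.continuousOn.comp (f := fun γ : G => (γ, p.2))
      (by fun_prop) fun γ hγ => ?_)
    have h2 : 𝒢.r γ = p.1 := hγ
    change (𝒢.r γ, p.2) ∈ U
    rw [h2]
    exact hp
  · rw [image_eq_zero_of_notMem_tsupport fun h => hγ (hfχ h), zero_mul]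

/-- Integrals over the `r`-fibers of functions with locally uniformly compact supports. -/
theorem ckZeroOn_integral_fibre (hM : IsDensityMeasure d M) (hd : 𝒢.leftSpace.IsDensity N d)
    {E : Type} [NormedAddCommGroup E] [NormedSpace ℝ E] [LocallyCompactSpace E]
    {U : Set (B × E)} (hU : IsOpen U) {n : ℕ} {F : G → E → ℝ}
    (hF : CkZeroOn n {q : G × E | (𝒢.r q.1, q.2) ∈ U} F)
    (hK : ∀ v ∈ U, ∃ Y ∈ 𝓝 v, ∃ K : Set G, IsCompact K ∧ ∀ v' ∈ Y, ∀ γ, 𝒢.r γ = v'.1 → γ ∉ K →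
      F γ v'.2 = 0) :
    CkZeroOn n U fun u w => ∫ γ, F γ w ∂M u := by
  refine CkZeroOn.of_local fun v hv => ?_
  obtain ⟨Y, hY, K, hK, hYK⟩ := hK v hv
  choose c hc hxc using 𝒢.leftSpace.fam.cover
  let χ : G → 𝒢.leftSpace.Chart := fun γ => ⟨c γ, 𝒢.leftSpace.fam.isChart_of_mem_atlas (hc γ)⟩
  obtain ⟨t, -, ht⟩ := hK.elim_nhds_subcover (fun γ => (c γ).source) fun γ _ =>
    (c γ).open_source.mem_nhds (hxc γ)
  let e := t.equivFin.symm
  -- A partition of unity on K reduces to integrands supported in one chart. It need only be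
  -- continuous, since differentiation is in E.
  obtain ⟨f, hfs, hf1, -, hfc⟩ := exists_continuous_sum_one_of_isOpen_isCompact
    (s := fun i => (c (e i)).source) (fun i => (c (e i)).open_source) hK (by
      intro γ hγ
      obtain ⟨γ', hγ', h⟩ := mem_iUnion₂.1 (ht hγ)
      exact mem_iUnion.2 ⟨t.equivFin ⟨γ', hγ'⟩, by simpa [e] using h⟩)
  have hVo : IsOpen (interior Y ∩ U) := isOpen_interior.inter hU
  refine ⟨_, hVo, ⟨mem_interior_iff_mem_nhds.2 hY, hv⟩, ?_⟩
  have hsum := CkZeroOn.sum Finset.univ (n := n) hVo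
    (f := fun i u w => ∫ γ, f i γ * F γ w ∂M u) fun i _ =>
    (ckZeroOn_integral_smul hM hd hU hF (χ (e i)) (f i) (hfc i) (hfs i)).mono inter_subset_right
  refine hsum.congr hVo fun p hp => ?_
  have hFc : ContinuousOn (fun γ => F γ p.2) {γ | 𝒢.leftSpace.p γ = p.1} :=
    hF.continuousOn.comp (f := fun γ : G => (γ, p.2)) (by fun_prop) fun γ hγ => by
      have h2 : 𝒢.r γ = p.1 := hγ
      change (𝒢.r γ, p.2) ∈ U
      rw [h2]
      exact hp.2
  rw [← integral_finsetSum]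
  · refine integral_congr_ae ?_
    filter_upwards [hM.ae_proj p.1] with γ hγ
    rw [← Finset.sum_mul]
    by_cases hγK : γ ∈ K
    · have := hf1 hγK
      simp only [Finset.sum_apply, Pi.one_apply] at this
      rw [this, one_mul]
    · rw [hYK p (interior_subset hp.1) γ hγ hγK, mul_zero]
  · intro i _
    refine hM.integrable hd p.1 ((f i).continuous.continuousOn.mul hFc) (hfc i).isCompact
      fun γ _ hγ => ?_
    rw [image_eq_zero_of_notMem_tsupport hγ, zero_mul]

variable {S : CInfZeroSpace 𝒢 X} [T2Space X] [LocallyCompactSpace B]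

/-- The average of a compactly supported density over the `r`-fibers. -/
theorem isDensity_integral_translate (hM : IsDensityMeasure d M) (hd : 𝒢.leftSpace.IsDensity N d)
    (hS : S.IsProper) {φ₀ : S.Chart} {β : B → Model S.fam.dim → ℝ}
    (hβ : ∀ n, CkZeroOn n univ β) (hβ0 : ∀ u w, 0 ≤ β u w) {C : Set (B × Model S.fam.dim)}
    (hC : IsCompact C) (hCφ : C ⊆ φ₀.1.target) (hβC : ∀ v ∉ C, β v.1 v.2 = 0) :
    S.IsDensity ⊤ fun φ u w => ∫ γ, translate φ₀ β φ γ w ∂M u where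
  nonneg φ v _ := integral_nonneg fun γ => translate_nonneg φ₀ hβ0 φ γ v.2
  equivariant φ ψ g w h := by
    have hc : ContinuousOn (fun γ => translate φ₀ β ψ γ (S.actRep φ.1 ψ.1 g w))
        {γ | 𝒢.leftSpace.p γ = 𝒢.r g} :=
      (ckZeroOn_translate (hβ 0) hC hCφ hβC ψ).continuousOn.comp
        (f := fun γ => (γ, S.actRep φ.1 ψ.1 g w)) (by fun_prop) fun γ hγ => by
          have h2 : 𝒢.r γ = 𝒢.r g := hγ
          change (𝒢.r γ, S.actRep φ.1 ψ.1 g w) ∈ ψ.1.target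
          rw [h2]
          exact actRep_mem_target h
    have hm := hM.aestronglyMeasurable (𝒢.r g) hc
    have hmap := hM.map_smul hd g
    rw [← hmap] at hm
    -- Substituting gγ for γ, by left invariance of M, moves the integral to the fiber over s(g),
    -- where `translate_prod` compares the integrands.
    rw [← hmap, integral_map (hM.aemeasurable_smul g) hm, ← integral_mul_const]
    refine integral_congr_ae ?_
    filter_upwards [hM.ae_proj (𝒢.s g)] with γ hγ
    exact translate_prod φ₀ β h (Eq.symm hγ)
  ckZeroOn n _ φ := by
    refine ckZeroOn_integral_fibre hM hd φ.1.open_target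
      (ckZeroOn_translate (hβ n) hC hCφ hβC φ) fun v hv => ?_
    obtain ⟨Y, hY, hvY, hYφ⟩ := exists_compact_subset φ.1.open_target hv
    obtain ⟨K, hK, h⟩ := hS.exists_isCompact hC hCφ hβC hY hYφ
    exact ⟨Y, mem_interior_iff_mem_nhds.1 hvY, K, hK, h⟩

/-- The average of a bump around x is positive at x: the integrand is continuous and nonnegative,
and at the unit over p(x) it is the value of the bump at x times a positive Jacobian. -/
theorem exists_isDensity_pos_at (hM : IsDensityMeasure d M) (hd : 𝒢.leftSpace.IsDensity N d)
    (hpos : ∀ φ : 𝒢.leftSpace.Chart, ∀ v ∈ φ.1.target, 0 < d φ v.1 v.2)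
    (hS : S.IsProper) (x : X) : ∃ d : S.Chart → B → Model S.fam.dim → ℝ, S.IsDensity ⊤ d ∧
      ∃ φ : S.Chart, x ∈ φ.1.source ∧ 0 < d φ (S.p x) (φ.1 x).2 := by
  obtain ⟨φ', hφ', hx⟩ := S.fam.cover x
  let φ : S.Chart := ⟨φ', S.fam.isChart_of_mem_atlas hφ'⟩
  -- The target of φ is a product, so a continuous bump on the base times a smooth bump on V has
  -- compact support in it.
  obtain ⟨V, hV, hVt⟩ := φ.2.1.2
  have hxt : (S.p x, (φ.1 x).2) ∈ φ.1.target := φ.2.1.mk_snd_mem hx rfl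
  have hxt' := hxt
  rw [hVt] at hxt'
  obtain ⟨a, C₁, hC₁, hC₁p, haC, ha0, hax⟩ := exists_continuous_bump
    (S.fam.isOpenMap_proj _ φ.1.open_source) hxt'.1
  obtain ⟨b, hbV, hbc, hb, hb01, hbx⟩ := exists_contDiff_tsupport_subset (n := ⊤)
    (hV.mem_nhds hxt'.2)
  let β : B → Model S.fam.dim → ℝ := fun u w => a u * b w
  have hβ : ∀ n, CkZeroOn n univ β := fun n =>
    (CkZeroOn.const (by fun_prop)).mul isOpen_univ
      (CkZeroOn.of_contDiffOn isOpen_univ (hb.of_le (by exact_mod_cast le_top)).contDiffOn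
        fun _ _ => trivial)
  have hβ0 : ∀ u w, 0 ≤ β u w := fun u w => mul_nonneg (ha0 u) (hb01 (mem_range_self w)).1
  have hC : IsCompact (C₁ ×ˢ tsupport b) := hC₁.prod hbc.isCompact
  have hCφ : C₁ ×ˢ tsupport b ⊆ φ.1.target := by
    rw [hVt]
    exact prod_mono hC₁p hbV
  have hβC : ∀ v ∉ C₁ ×ˢ tsupport b, β v.1 v.2 = 0 := by
    intro v hv
    by_cases h1 : v.1 ∈ C₁
    · have h2 : v.2 ∉ tsupport b := fun h => hv ⟨h1, h⟩
      simp only [β, image_eq_zero_of_notMem_tsupport h2, mul_zero]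
    · simp only [β, haC _ h1, zero_mul]
  refine ⟨_, isDensity_integral_translate hM hd hS hβ hβ0 hC hCφ hβC, φ, hx, ?_⟩
  obtain ⟨K, hK, hYK⟩ := hS.exists_isCompact (φ := φ) hC hCφ hβC
    (isCompact_singleton (x := (S.p x, (φ.1 x).2))) (singleton_subset_iff.2 hxt)
  refine hM.integral_pos hd hpos (S.p x) ?_ hK (fun γ hγ hγK => hYK _ rfl γ hγ hγK)
    (fun γ => translate_nonneg φ hβ0 φ γ _) (x := 𝒢.unit (S.p x)) (𝒢.r_unit _) ?_
  · refine (ckZeroOn_translate (hβ 0) hC hCφ hβC φ).continuousOn.comp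
      (f := fun γ => (γ, (φ.1 x).2)) (by fun_prop) fun γ hγ => ?_
    have h2 : 𝒢.r γ = S.p x := hγ
    change (𝒢.r γ, (φ.1 x).2) ∈ φ.1.target
    rw [h2]
    exact hxt
  · have hm : (𝒢.unit (S.p x), (φ.1 x).2) ∈ S.actDom φ.1 φ.1 :=
      (mem_actDom_unit hxt).2 (φ.1.map_target hxt)
    rw [translate, inv_unit, if_pos hm, actRep_unit_self hxt, 𝒢.s_unit]
    refine (mul_pos ?_ (jac_pos hm)).ne'
    simp only [β, hax, hbx, mul_one, zero_lt_one]

end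

/-! ### Properness of G over itself and conclusion -/

section

variable {G B X : Type*} [TopologicalSpace G] [TopologicalSpace B] [TopologicalSpace X]
  {𝒢 : ContinuousFamilyGroupoid G B}

/-- The units form a continuous section of r in a Hausdorff space. Through this embedding B inherits
the topological properties of G. -/
theorem _root_.CFam.ContinuousFamilyGroupoid.isClosedEmbedding_unit [T2Space G]
    (𝒢 : ContinuousFamilyGroupoid G B) : IsClosedEmbedding 𝒢.unit := by
  have h : Function.LeftInverse 𝒢.r 𝒢.unit := 𝒢.r_unit
  exact h.isClosedEmbedding 𝒢.continuous_r 𝒢.continuous_unit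

/-- The map (g, h) ↦ (gh, h) is a homeomorphism onto the closed set of pairs with equal source, with
inverse (k, h) ↦ (kh⁻¹, h); a closed embedding is proper. -/
theorem isProper_leftSpace [T2Space G] (𝒢 : ContinuousFamilyGroupoid G B) :
    𝒢.leftSpace.IsProper := by
  have := 𝒢.isClosedEmbedding_unit.isEmbedding.t2Space
  have hs := 𝒢.continuous_s
  have hinv := 𝒢.continuous_inv
  refine IsClosedEmbedding.isProperMap ?_
  have hcl : IsClosed {q : G × G | 𝒢.s q.1 = 𝒢.s q.2} :=
    isClosed_eq (hs.comp continuous_fst) (hs.comp continuous_snd)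
  let T : Function.Pullback 𝒢.s 𝒢.r → {q : G × G // 𝒢.s q.1 = 𝒢.s q.2} := fun z =>
    ⟨(𝒢.mul z.1.1 z.1.2 z.2, z.1.2), 𝒢.s_mul _ _ _⟩
  have hT : Continuous T :=
    Continuous.subtype_mk (𝒢.continuous_mul.prodMk (continuous_snd.comp continuous_subtype_val)) _
  let T' : {q : G × G // 𝒢.s q.1 = 𝒢.s q.2} → Function.Pullback 𝒢.s 𝒢.r := fun q =>
    ⟨(𝒢.prod q.1.1 (𝒢.inv q.1.2), q.1.2), by
      have e : 𝒢.s q.1.1 = 𝒢.r (𝒢.inv q.1.2) := q.2.trans (𝒢.r_inv _).symm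
      exact (s_prod e).trans (𝒢.s_inv _)⟩
  have hT' : Continuous T' := by
    refine Continuous.subtype_mk (Continuous.prodMk ?_ (by fun_prop)) _
    exact (continuousOn_smul (S := 𝒢.leftSpace)).comp_continuous
      (f := fun q : {q : G × G // 𝒢.s q.1 = 𝒢.s q.2} => (q.1.1, 𝒢.inv q.1.2)) (by fun_prop)
      fun q => q.2.trans (𝒢.r_inv _).symm
  have h1 : Function.LeftInverse T' T := by
    rintro ⟨⟨g, h⟩, e⟩
    apply Subtype.ext
    refine Prod.ext ?_ rfl
    have e : 𝒢.s g = 𝒢.r h := e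
    change 𝒢.prod (𝒢.mul g h e) (𝒢.inv h) = g
    rw [← prod_eq e, ← prod_assoc e (𝒢.r_inv h).symm, prod_inv, prod_unit e]
  have h2 : Function.RightInverse T' T := by
    rintro ⟨⟨g, h⟩, e⟩
    apply Subtype.ext
    refine Prod.ext ?_ rfl
    have e : 𝒢.s g = 𝒢.s h := e
    change 𝒢.mul (𝒢.prod g (𝒢.inv h)) h _ = g
    rw [← ContinuousFamilyGroupoid.prod_eq, ← prod_assoc (e.trans (𝒢.r_inv h).symm) (𝒢.s_inv h), inv_prod_self,
      prod_unit e]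
  let H : Function.Pullback 𝒢.s 𝒢.r ≃ₜ {q : G × G // 𝒢.s q.1 = 𝒢.s q.2} :=
    ⟨⟨T, T', h1, h2⟩, hT, hT'⟩
  exact hcl.isClosedEmbedding_subtypeVal.comp H.isClosedEmbedding

theorem exists_isCInfZeroHaarSystem [T2Space G] [LocallyCompactSpace G]
    [SecondCountableTopology G] [MeasurableSpace G] [BorelSpace G] [T2Space X]
    [SecondCountableTopology X] [MeasurableSpace X] [BorelSpace X] {S : CInfZeroSpace 𝒢 X}
    (hS : S.IsProper) : ∃ μ : (u : B) → Measure (Fibre S.p u), IsCInfZeroHaarSystem S μ := by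
  have := 𝒢.isClosedEmbedding_unit.isEmbedding.t2Space
  have := 𝒢.isClosedEmbedding_unit.locallyCompactSpace
  have := 𝒢.isClosedEmbedding_unit.isEmbedding.secondCountableTopology
  obtain ⟨d, hd, hdpos⟩ := exists_isDensity_leftSpace 𝒢
  obtain ⟨M, hM⟩ := exists_isDensityMeasure hd
  obtain ⟨d', hd', hdpos'⟩ := exists_isDensity_pos (exists_isDensity_pos_at hM hd hdpos hS)
  obtain ⟨M', hM'⟩ := exists_isDensityMeasure hd'
  exact ⟨_, isCInfZeroHaarSystem_fibreMeasure hd' hdpos' hM'⟩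

end

end CInfZeroSpace

end CFam

theorem mainTheorem7 {G B : Type*} [TopologicalSpace G] [T2Space G] [LocallyCompactSpace G]
    [SecondCountableTopology G] [MeasurableSpace G] [BorelSpace G] [TopologicalSpace B]
    (𝒢 : CFam.ContinuousFamilyGroupoid G B) :
    (∀ (X : Type*) [TopologicalSpace X] [T2Space X] [LocallyCompactSpace X]
        [SecondCountableTopology X] [MeasurableSpace X] [BorelSpace X]
        (S : CFam.CInfZeroSpace 𝒢 X), S.IsProper →
        ∃ μ : (u : B) → MeasureTheory.Measure (CFam.Fibre S.p u),
          CFam.IsCInfZeroHaarSystem S μ) ∧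
      ∃ μ : (u : B) → MeasureTheory.Measure (CFam.Fibre 𝒢.leftSpace.p u),
        CFam.IsCInfZeroHaarSystem 𝒢.leftSpace μ :=
  ⟨fun _ _ _ _ _ _ _ _ hS => CFam.CInfZeroSpace.exists_isCInfZeroHaarSystem hS,
    CFam.CInfZeroSpace.exists_isCInfZeroHaarSystem (CFam.CInfZeroSpace.isProper_leftSpace 𝒢)⟩
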